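/- Let $n\in\{2,3\}$, let $\Omega\subset\mathbb R^n$ be a convex polygonal (polyhedral) domain, let $0<T<\infty$, $I=(0,T)$, and let $0<c_1\le c_2<\infty$. Write $H=L^2(\Omega)$, $V=H^1_0(\Omega)$ and $a(u,v)=\int_\Omega\nabla u\cdot\nabla v\,dx$. There is a constant $C>0$, depending only on $\Omega,T,c_1,c_2$, such that the following holds. Let $f\in H^1(I,H)$ with $f(0)\in V$, and let $\kappa\in V$ with $\Delta\kappa\in V$. Let $y\in L^2(I,V)$ with $\partial_t y\in L^2(I,H^{-1}(\Omega))$ be the weak solution of $\partial_t y-\Delta y=f$ in $I\times\Omega$, $y=0$ on $I\times\partial\Omega$, $y(0)=\kappa$. Then $\partial_t y$, $\partial_t^2 y$, $\Delta y$ and $\partial_t\Delta y$ exist as weak derivatives in $L^2(I,H)$. Moreover, for every partition $0=t_0<t_1<\dots<t_M=T$, $M\ge2$, with step sizes $k_m=t_m-t_{m-1}$ satisfying $c_1\le k_m/k_{m+1}\le c_2$ for $m=1,\dots,M-1$, and with $k=\max_m k_m$, and for every Petrov–Galerkin approximation $y_k$ of $y$ on this partition, $$\|\pi_{P_k^*}y_k-y\|_{L^2(I,L^2(\Omega))}\le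 C k^2\left(\|\partial_t^2y\|_{L^2(I,L^2(\Omega))}+\|\partial_t\Delta y\|_{L^2(I,L^2(\Omega))}\right).$$ Here a Petrov–Galerkin approximation $y_k$ is a function with constant values in $V$ on each $[t_{m-1},t_m)$ and a final value $y_k(T)\in H$, such that $$\int_0^T\left(-(\partial_tv(t),y_k(t))_H+a(y_k(t),v(t))\right)dt+(y_k(T),v(T))_H=\int_0^T(f(t),v(t))_H\,dt+(\kappa,v(0))_H$$ for all $v\in C([0,T],V)$ that are affine in $t$ on each $[t_{m-1},t_m)$. With the midpoints $t_m^*=(t_{m-1}+t_m)/2$, $m=1,\dots,M$, the dual-grid interpolant $\pi_{P_k^*}y_k:[0,T]\to V$ is the continuous function that is affine between consecutive midpoints, satisfies $(\pi_{P_k^*}y_k)(t_m^*)=y_k(t_m^*)$ for all $m$, and is continued affinely from $[t_1^*,t_2^*]$ to $[0,t_2^*]$ and from $[t_{M-1}^*,t_M^*]$ to $[t_{M-1}^*,T]$. -/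

import Mathlib

open MeasureTheory Set Filter Topology
open scoped ContDiff ENNReal

namespace PetrovGalerkin

noncomputable section

/-! ### Spatial domain and function spaces -/

/-- The Euclidean space `ℝⁿ`. -/
abbrev Space (n : ℕ) : Type := EuclideanSpace ℝ (Fin n)

/-- `Ω` is a convex polygonal (polyhedral) domain: the nonempty interior of the convex hull of
finitely many points. -/
def IsConvexPolygonalDomain {n : ℕ} (Ω : Set (Space n)) : Prop :=
  Ω.Nonempty ∧ ∃ S : Set (Space n), S.Finite ∧ Ω = interior (convexHull ℝ S)

/-- `φ ∈ C_c^∞(U)`: smooth real functions whose support is compact and contained in `U`. -/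
structure IsTestFunction {E : Type*} [NormedAddCommGroup E] [NormedSpace ℝ E]
    (U : Set E) (φ : E → ℝ) : Prop where
  smooth : ContDiff ℝ ∞ φ
  compact : HasCompactSupport φ
  support : tsupport φ ⊆ U

/-- The Lebesgue space `L²(Ω)`. -/
abbrev L2 {n : ℕ} (Ω : Set (Space n)) : Type :=
  Lp ℝ 2 (volume.restrict Ω)

/-- The Lebesgue space `L²(Ω; ℝⁿ)` of vector fields. -/
abbrev L2Vec {n : ℕ} (Ω : Set (Space n)) : Type :=
  Lp (Space n) 2 (volume.restrict Ω)

/-- `H¹₀(Ω)`, the closure of `C_c^∞(Ω)` in the `H¹(Ω)` norm. A function `u` is recorded together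
with its gradient as `(u, ∇u)` in the Hilbert sum of `L²(Ω)` and `L²(Ω; ℝⁿ)`, whose norm restricts
to the `H¹` norm `(‖u‖² + ‖∇u‖²)^(1/2)`. -/
def H10Submodule {n : ℕ} (Ω : Set (Space n)) : Submodule ℝ (WithLp 2 (L2 Ω × L2Vec Ω)) :=
  (Submodule.span ℝ {p | ∃ φ : Space n → ℝ, IsTestFunction Ω φ ∧
    (p.fst : Space n → ℝ) =ᵐ[volume.restrict Ω] φ ∧
    (p.snd : Space n → Space n) =ᵐ[volume.restrict Ω] gradient φ}).topologicalClosure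

/-- The Hilbert space `H¹₀(Ω)`. -/
abbrev H10 {n : ℕ} (Ω : Set (Space n)) : Type := H10Submodule Ω

/-- The dual space `H⁻¹(Ω)` of `H¹₀(Ω)`; the duality pairing is evaluation. -/
abbrev Hm1 {n : ℕ} (Ω : Set (Space n)) : Type := H10 Ω →L[ℝ] ℝ

/-- The embedding `H¹₀(Ω) ↪ L²(Ω)`. -/
def val {n : ℕ} {Ω : Set (Space n)} : H10 Ω →L[ℝ] L2 Ω :=
  (WithLp.fstL 2 ℝ (L2 Ω) (L2Vec Ω)).comp (H10Submodule Ω).subtypeL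

/-- The gradient `∇ : H¹₀(Ω) → L²(Ω; ℝⁿ)`. -/
def grad {n : ℕ} {Ω : Set (Space n)} : H10 Ω →L[ℝ] L2Vec Ω :=
  (WithLp.sndL 2 ℝ (L2 Ω) (L2Vec Ω)).comp (H10Submodule Ω).subtypeL

/-- The embedding `L²(Ω) ↪ H⁻¹(Ω)`, `g ↦ (g, ·)_{L²(Ω)}`. -/
def toHm1 {n : ℕ} {Ω : Set (Space n)} (g : L2 Ω) : Hm1 Ω :=
  (innerSL ℝ g).comp val

/-- The bilinear form `a(u,v) = ∫_Ω ∇u · ∇v dx` on `H¹₀(Ω)`. -/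
def aForm {n : ℕ} {Ω : Set (Space n)} (u v : H10 Ω) : ℝ := inner ℝ (grad u) (grad v)

/-- `Δu = g` in the sense of distributions on `Ω`, for `u, g ∈ L²(Ω)`. -/
def HasLaplacian {n : ℕ} {Ω : Set (Space n)} (u g : L2 Ω) : Prop :=
  ∀ φ : Space n → ℝ, IsTestFunction Ω φ →
    ∫ x in Ω, u x * Laplacian.laplacian φ x = ∫ x in Ω, g x * φ x

/-! ### Functions of time on `I = (0,T)` -/

section Time

variable {X : Type*} [NormedAddCommGroup X] [NormedSpace ℝ X]

/-- `u ∈ L²(I, X)`, `I = (0,T)`. -/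
def MemL2 (T : ℝ) (u : ℝ → X) : Prop := MemLp u 2 (volume.restrict (Ioo 0 T))

/-- The norm of `L²(I, X)`, `I = (0,T)`, as an extended nonnegative real. -/
def normL2 (T : ℝ) (u : ℝ → X) : ℝ≥0∞ := eLpNorm u 2 (volume.restrict (Ioo 0 T))

/-- `u ∈ H¹(I, X)` with weak time derivative `∂_t u = u'`, `I = (0,T)`. -/
structure HasWeakTimeDeriv (T : ℝ) (u u' : ℝ → X) : Prop where
  memL2 : MemL2 T u
  memL2_deriv : MemL2 T u'
  weak : ∀ φ : ℝ → ℝ, IsTestFunction (Ioo 0 T) φ →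
    ∫ t in Ioo 0 T, deriv φ t • u t = - ∫ t in Ioo 0 T, φ t • u' t

/-- `u(0) = x`: the function `u`, given up to null sets on `I = (0,T)`, has a representative in
`C([0,T], X)` with value `x` at `0`. -/
def HasInitialValue (T : ℝ) (u : ℝ → X) (x : X) : Prop :=
  ∃ c : ℝ → X, ContinuousOn c (Icc 0 T) ∧
    (∀ᵐ t ∂(volume.restrict (Ioo 0 T)), c t = u t) ∧ c 0 = x

end Time

/-! ### The parabolic problem -/

/-- `y ∈ W(I)` is the weak solution of `∂_t y - Δy = F` in `I × Ω`, `y = 0` on `I × ∂Ω`,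
`y(0) = κ`, for `F ∈ L²(I, H⁻¹(Ω))` and `κ ∈ L²(Ω)`. -/
structure IsWeakSolution {n : ℕ} {Ω : Set (Space n)} (T : ℝ) (F : ℝ → Hm1 Ω) (κ : L2 Ω)
    (y : ℝ → H10 Ω) : Prop where
  memL2 : MemL2 T y
  initial : HasInitialValue T (fun t => val (y t)) κ
  equation : ∃ y' : ℝ → Hm1 Ω, HasWeakTimeDeriv T (fun t => toHm1 (val (y t))) y' ∧
    ∀ v : ℝ → H10 Ω, MemL2 T v →
      ∫ t in Ioo 0 T, (y' t (v t) + aForm (y t) (v t)) = ∫ t in Ioo 0 T, F t (v t)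

/-- The bilinear form
`A(y,v) = ∫_0^T (-⟨∂_t v(t), y(t)⟩ + a(y(t),v(t))) dt + (y(T), v(T))_{L²(Ω)}`,
as a function of `y`, its final value `yT`, `v`, and the time derivative `v'` of `v`. -/
def formA {n : ℕ} {Ω : Set (Space n)} (T : ℝ) (y : ℝ → H10 Ω) (yT : L2 Ω)
    (v : ℝ → H10 Ω) (v' : ℝ → Hm1 Ω) : ℝ :=
  (∫ t in Ioo 0 T, (-(v' t (y t)) + aForm (y t) (v t))) + inner ℝ yT (val (v T))

/-! ### Time grids and discrete spaces -/

/-- A partition `0 = t₀ < t₁ < ⋯ < t_M = T`. Values `t m` with `m > M` play no role. Subintervals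
are numbered from `0`: the `m`-th one is `[t m, t (m+1))`, `m < M`. -/
structure TimeGrid (T : ℝ) where
  M : ℕ
  t : ℕ → ℝ
  zero : t 0 = 0
  last : t M = T
  lt : ∀ m < M, t m < t (m + 1)

namespace TimeGrid

variable {T : ℝ} (G : TimeGrid T)

/-- The length of the `m`-th subinterval. -/
def step (m : ℕ) : ℝ := G.t (m + 1) - G.t m

/-- The grid width `k`, the maximal length of the subintervals. -/
def width : ℝ := ⨆ m : Fin G.M, G.step m

/-- The midpoint of the `m`-th subinterval; these are the interior nodes of the dual partition. -/
def mid (m : ℕ) : ℝ := (G.t m + G.t (m + 1)) / 2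

/-- The condition `c₁ ≤ k_m / k_{m+1} ≤ c₂` on the lengths of neighbouring subintervals. -/
def IsQuasiUniform (c₁ c₂ : ℝ) : Prop :=
  ∀ m, m + 1 < G.M → c₁ ≤ G.step m / G.step (m + 1) ∧ G.step m / G.step (m + 1) ≤ c₂

/-- Restricted to `[0,T)`, the function `v` is piecewise constant on the primal partition. -/
def IsPiecewiseConst {X : Type*} (v : ℝ → X) : Prop :=
  ∀ m < G.M, ∃ α : X, ∀ s ∈ Ico (G.t m) (G.t (m + 1)), v s = α

/-- `v ∈ C([0,T], X)` is piecewise affine on the primal partition (the test space `P_k`). -/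
def IsPiecewiseLinear {X : Type*} [NormedAddCommGroup X] [NormedSpace ℝ X] (v : ℝ → X) : Prop :=
  ContinuousOn v (Icc 0 T) ∧
    ∀ m < G.M, ∃ α β : X, ∀ s ∈ Ico (G.t m) (G.t (m + 1)), v s = α + s • β

open Classical in
/-- The number `j` of the pair of neighbouring midpoints `mid j`, `mid (j+1)` from which the dual
interpolant is computed at time `s`: the largest `j ≤ M - 2` with `mid j ≤ s`, and `0` if
`s < mid 0`. -/
def dualIndex (s : ℝ) : ℕ := Nat.findGreatest (fun j => G.mid j ≤ s) (G.M - 2)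

/-- The dual-grid interpolant of `v`: it is continuous and piecewise affine, interpolates `v` at all
midpoints, and is extended affinely to the first and the last half interval. It is meant for
grids with at least two subintervals. -/
def dualInterp {X : Type*} [AddCommGroup X] [Module ℝ X] (v : ℝ → X) (s : ℝ) : X :=
  let j := G.dualIndex s
  v (G.mid j) + ((s - G.mid j) / (G.mid (j + 1) - G.mid j)) • (v (G.mid (j + 1)) - v (G.mid j))

/-- The affine pieces of the dual interpolant: it is the line through the `j`-th and `(j+1)`-th
midpoint values on `[mid j, mid (j+1))`, also to the left of `mid j` if `j = 0`, and also to the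
right of `mid (j+1)` if these are the last two midpoints. -/
theorem dualInterp_eq {X : Type*} [AddCommGroup X] [Module ℝ X] (v : ℝ → X) {s : ℝ} {j : ℕ}
    (hj : j + 2 ≤ G.M) (h₁ : j = 0 ∨ G.mid j ≤ s) (h₂ : j + 2 = G.M ∨ s < G.mid (j + 1)) :
    G.dualInterp v s = v (G.mid j) +
      ((s - G.mid j) / (G.mid (j + 1) - G.mid j)) • (v (G.mid (j + 1)) - v (G.mid j)) := by
  have mono : ∀ i l, i ≤ l → l < G.M → G.mid i ≤ G.mid l := by
    intro i l hil
    induction l, hil using Nat.le_induction with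
    | base => intro _; exact le_rfl
    | succ l _ ih =>
      intro hl
      have e₁ := ih (by omega)
      have e₂ := G.lt l (by omega)
      have e₃ := G.lt (l + 1) hl
      have e₄ : G.mid l ≤ G.mid (l + 1) := by unfold mid; linarith
      exact e₁.trans e₄
  have hidx : G.dualIndex s = j := by
    unfold dualIndex
    rw [Nat.findGreatest_eq_iff]
    refine ⟨by omega, fun h => h₁.resolve_left h, fun l hl hl' hs => ?_⟩
    rcases h₂ with h₂ | h₂
    · omega
    · exact absurd (h₂.trans_le (mono (j + 1) l hl (by omega))) (not_lt.mpr hs)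
  simp only [dualInterp, hidx]

end TimeGrid

/-- The Petrov–Galerkin approximation of the weak solution with data `F`, `κ`: a piecewise constant
`yk : [0,T) → H¹₀(Ω)` with a final value `ykT` such that
`A(yk, v) = ∫_0^T ⟨F(t), v(t)⟩ dt + (κ, v(0))` for all `v ∈ P_k`.
The time derivative of `v ∈ P_k` is the piecewise classical one. The final value is only
required to lie in `L²(Ω)`, since in general the equation tested near `T` determines it as an
element of `L²(Ω)`, not of `H¹₀(Ω)`. -/
structure IsDiscreteSolution {n : ℕ} {Ω : Set (Space n)} {T : ℝ} (G : TimeGrid T)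
    (F : ℝ → Hm1 Ω) (κ : L2 Ω) (yk : ℝ → H10 Ω) (ykT : L2 Ω) : Prop where
  piecewise : G.IsPiecewiseConst yk
  equation : ∀ v : ℝ → H10 Ω, G.IsPiecewiseLinear v →
    formA T yk ykT v (fun t => toHm1 (val (deriv v t)))
      = (∫ t in Ioo 0 T, F t (v t)) + inner ℝ κ (val (v 0))

end

end PetrovGalerkin

open PetrovGalerkin

namespace PetrovGalerkin

noncomputable section

/-! ### Primitives and weak time derivatives -/

section Primitive

variable {E F W : Type*} [NormedAddCommGroup E] [NormedSpace ℝ E] [NormedAddCommGroup F]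
  [NormedSpace ℝ F] [NormedAddCommGroup W] [NormedSpace ℝ W]

/-! Apart from Green's formula, everything takes place for Hilbert spaces and a map `ι : V →L[ℝ] H`
with ‖ι v‖ ≤ ‖v‖. The Dirichlet form becomes `energy ι`; let A be the operator it induces. Equations
with A are meant variationally. On H¹₀(Ω) this agrees with the distributional Laplacian, by density
of test functions (`hasLaplacian_val_iff`), so no elliptic regularity enters.

Regularity. The time-differentiated problem w' + A w = f', w(0) = f(0) + Δκ ∈ V is solved with w' ∈
L²(I, H) (`exists_strong_solution`). Applying R = ι ι*, which acts as (1 + A)⁻¹, leaves only bounded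
operators: R w' + (1 - R) w = R f'. Tested with ψ, this prescribes the inner products of the unknown
x = w' with certain functions S ψ. An energy identity for the backward primitive of ψ bounds the
data by ‖S ψ‖, and Hahn–Banach with Riesz yields x (`exists_very_weak_solution`). Integrating in
time gives Y with Y' = w, Y'' = x and A Y = f - w. The time-integrated equation has at most one
solution, so Y = y, and Δy = w - f has the derivative x - f'.

Error of the discrete values. These are compared with the interval means of y, not with its midpoint
values. For a piecewise affine test function with nodal values p, the means satisfy the discrete
equation up to residuals ρ_m = ∫ (t - t_m^*) / k_m · a(y, p_{m+1} - p_m) dt. The weight has mean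
zero, so ρ_m sees only the variation of Δy. If p solves the backward Crank–Nicolson problem with the
error e as data, then Σ k_m ‖e_m‖² = Σ ρ_m. Stability of that problem allows half of the left side
to be absorbed, leaving O(k⁴) (`sum_error_mean_le`).

Interpolation. Interval means placed at midpoints, followed by affine interpolation, reproduce
affine functions. A Taylor expansion therefore costs k² ‖∂_t² y‖. The errors at the midpoints enter
with bounded weights, and the bounds on neighbouring step ratios charge each of them to its own
subinterval (`normL2_dualInterp_sub_sq_le`). -/

/-- Integration by parts for two primitives. -/
theorem integral_bilin_primitive_add [CompleteSpace E] [CompleteSpace F] [CompleteSpace W]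
    (B : E →L[ℝ] F →L[ℝ] W) {φ : ℝ → E} {ψ : ℝ → F} {a b : ℝ} (hab : a ≤ b)
    (hφ : IntegrableOn φ (Ioc a b)) (hψ : IntegrableOn ψ (Ioc a b)) :
    (∫ t in a..b, B (φ t) (∫ s in a..t, ψ s)) + (∫ t in a..b, B (∫ s in a..t, φ s) (ψ t))
      = B (∫ s in a..b, φ s) (∫ s in a..b, ψ s) := by
  set μ := volume.restrict (Ioc a b) with hμ
  have hF : Integrable (fun z : ℝ × ℝ => B (φ z.1) (ψ z.2)) (μ.prod μ) :=
    Integrable.op_fst_snd (op := fun x y => B x y) (by fun_prop) ⟨‖B‖, B.le_opNorm₂⟩ hφ hψ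
  have hS : MeasurableSet {z : ℝ × ℝ | z.2 ≤ z.1} :=
    measurableSet_le measurable_snd measurable_fst
  -- The product of the two integrals is an integral over a square. It is split along the diagonal,
  -- and Fubini is applied on each half in the opposite order.
  rw [intervalIntegral.integral_of_le hab, intervalIntegral.integral_of_le hab,
    intervalIntegral.integral_of_le hab, intervalIntegral.integral_of_le hab, ← hμ,
    ← integral_prod_bilin B hφ hψ,
    ← integral_add_compl hS hF, ← integral_indicator hS, ← integral_indicator hS.compl,
    integral_prod _ (hF.indicator hS), integral_prod_symm _ (hF.indicator hS.compl)]
  congr 1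
  · refine setIntegral_congr_fun measurableSet_Ioc fun t ht => ?_
    have h1 : ∫ s in a..t, ψ s = ∫ s, (Iic t).indicator ψ s ∂μ := by
      rw [intervalIntegral.integral_of_le ht.1.le, integral_indicator measurableSet_Iic, hμ,
        Measure.restrict_restrict measurableSet_Iic]
      congr 2
      ext s; simp only [mem_Ioc, mem_inter_iff, mem_Iic]
      constructor
      · rintro ⟨h, h'⟩; exact ⟨h', h, h'.trans ht.2⟩
      · rintro ⟨h, h', _⟩; exact ⟨h', h⟩
    rw [h1, ← ContinuousLinearMap.integral_comp_comm _ (hψ.indicator measurableSet_Iic)]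
    refine integral_congr_ae (Eventually.of_forall fun s => ?_)
    by_cases hs : s ≤ t <;> simp [indicator, hs]
  · refine setIntegral_congr_fun measurableSet_Ioc fun t ht => ?_
    have h1 : ∫ s in a..t, φ s = ∫ s, (Iio t).indicator φ s ∂μ := by
      rw [intervalIntegral.integral_of_le ht.1.le, integral_Ioc_eq_integral_Ioo,
        integral_indicator measurableSet_Iio, hμ, Measure.restrict_restrict measurableSet_Iio]
      congr 2
      ext s; simp only [mem_Ioc, mem_Ioo, mem_inter_iff, mem_Iio]
      constructor
      · rintro ⟨h, h'⟩; exact ⟨h', h, h'.le.trans ht.2⟩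
      · rintro ⟨h, h', _⟩; exact ⟨h', h⟩
    rw [h1, ← ContinuousLinearMap.flip_apply,
      ← ContinuousLinearMap.integral_comp_comm _ (hφ.indicator measurableSet_Iio)]
    refine integral_congr_ae (Eventually.of_forall fun s => ?_)
    by_cases hs : s < t <;> simp [indicator, hs, not_le.mpr, not_lt.mp]

theorem MemL2.integrableOn_Ioc {X : Type*} [NormedAddCommGroup X] {T : ℝ} {u : ℝ → X}
    (hu : MemL2 T u) : IntegrableOn u (Ioc 0 T) := by
  rw [integrableOn_Ioc_iff_integrableOn_Ioo]
  exact MemLp.integrable one_le_two hu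

theorem MemL2.intervalIntegrable {X : Type*} [NormedAddCommGroup X] {T : ℝ} {u : ℝ → X}
    (hu : MemL2 T u) {a b : ℝ}
    (ha : a ∈ Icc 0 T) (hb : b ∈ Icc 0 T) : IntervalIntegrable u volume a b := by
  have h := hu.integrableOn_Ioc
  rw [intervalIntegrable_iff]
  refine h.mono_set fun s hs => ?_
  rw [mem_uIoc] at hs
  rcases hs with hs | hs
  · exact ⟨ha.1.trans_lt hs.1, hs.2.trans hb.2⟩
  · exact ⟨hb.1.trans_lt hs.1, hs.2.trans ha.2⟩

theorem continuousOn_primitive {T : ℝ} {u : ℝ → E} (hu : MemL2 T u) :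
    ContinuousOn (fun t => ∫ s in (0:ℝ)..t, u s) (Icc 0 T) := by
  have h := hu.integrableOn_Ioc
  rw [← integrableOn_Icc_iff_integrableOn_Ioc] at h
  exact intervalIntegral.continuousOn_primitive h |>.congr fun t ht =>
    intervalIntegral.integral_of_le ht.1

theorem memL2_of_continuousOn {X : Type*} [NormedAddCommGroup X] {T : ℝ} {u : ℝ → X}
    (hu : ContinuousOn u (Icc 0 T)) :
    MemL2 T u := by
  obtain ⟨C, hC⟩ := isCompact_Icc.exists_bound_of_continuousOn hu
  refine MemLp.of_bound ((hu.mono Ioo_subset_Icc_self).aestronglyMeasurable measurableSet_Ioo) C ?_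
  filter_upwards [self_mem_ae_restrict measurableSet_Ioo] with t ht
  exact hC t (Ioo_subset_Icc_self ht)

theorem integral_Ioo_eq_intervalIntegral {T : ℝ} (hT : 0 < T) (u : ℝ → E) :
    ∫ t in Ioo 0 T, u t = ∫ t in (0:ℝ)..T, u t := by
  rw [intervalIntegral.integral_of_le hT.le, integral_Ioc_eq_integral_Ioo]

theorem MemL2.integrable_smul {T : ℝ} {u : ℝ → E} (hu : MemL2 T u) {η : ℝ → ℝ}
    (hη : Continuous η) (hc : HasCompactSupport η) :
    Integrable (fun t => η t • u t) (volume.restrict (Ioo 0 T)) := by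
  obtain ⟨C, hC⟩ := hc.exists_bound_of_continuous hη
  exact (MemLp.integrable one_le_two hu).bdd_smul C hη.aestronglyMeasurable
    (Eventually.of_forall hC)

theorem exists_tsupport_subset_Icc {T : ℝ} (hT : 0 < T) {φ : ℝ → ℝ}
    (hφ : IsTestFunction (Ioo 0 T) φ) :
    ∃ a b, 0 < a ∧ a ≤ b ∧ b < T ∧ tsupport φ ⊆ Icc a b := by
  have hK : IsCompact (tsupport φ) := hφ.compact
  rcases (tsupport φ).eq_empty_or_nonempty with h | h
  · exact ⟨T / 2, T / 2, by linarith, le_rfl, by linarith, by simp [h]⟩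
  · obtain ⟨a, ha⟩ := hK.exists_isLeast h
    obtain ⟨b, hb⟩ := hK.exists_isGreatest h
    exact ⟨a, b, (hφ.support ha.1).1, ha.2 hb.1, (hφ.support hb.1).2,
      fun x hx => ⟨ha.2 hx, hb.2 hx⟩⟩

theorem IsTestFunction.deriv_eq {T : ℝ} {φ : ℝ → ℝ} (hφ : IsTestFunction (Ioo 0 T) φ) (t : ℝ) :
    φ t = ∫ s in (0:ℝ)..t, deriv φ s := by
  have h0 : φ 0 = 0 := by
    apply image_eq_zero_of_notMem_tsupport
    intro h
    exact lt_irrefl _ (hφ.support h).1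
  rw [intervalIntegral.integral_deriv_eq_sub
    (fun x _ => (hφ.smooth.differentiable (by simp)).differentiableAt), h0, sub_zero]
  exact ((hφ.smooth.continuous_deriv (by simp)).intervalIntegrable _ _)

/-- A primitive of an `L²` function is weakly differentiable. -/
theorem hasWeakTimeDeriv_of_primitive [CompleteSpace E] {T : ℝ} (hT : 0 < T) {u u' : ℝ → E} (x : E)
    (hu' : MemL2 T u')
    (hu : ∀ᵐ t ∂(volume.restrict (Ioo 0 T)), u t = x + ∫ s in (0:ℝ)..t, u' s) :
    HasWeakTimeDeriv T u u' where
  memL2 := by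
    have h : MemL2 T (fun t => x + ∫ s in (0:ℝ)..t, u' s) :=
      memL2_of_continuousOn (continuousOn_const.add (continuousOn_primitive hu'))
    exact (memLp_congr_ae hu).mpr h
  memL2_deriv := hu'
  weak φ hφ := by
    have hd : Continuous (deriv φ) := hφ.smooth.continuous_deriv (by simp)
    have hφT : φ T = 0 := by
      apply image_eq_zero_of_notMem_tsupport
      intro h
      exact lt_irrefl _ (hφ.support h).2
    have h1 : ∫ t in Ioo 0 T, deriv φ t • u t
        = ∫ t in Ioo 0 T, (deriv φ t • x + deriv φ t • ∫ s in (0:ℝ)..t, u' s) := by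
      refine integral_congr_ae ?_
      filter_upwards [hu] with t ht
      rw [ht, smul_add]
    have hc : ContinuousOn (fun t => deriv φ t • ∫ s in (0:ℝ)..t, u' s) (Icc 0 T) :=
      hd.continuousOn.smul (continuousOn_primitive hu')
    have key := integral_bilin_primitive_add (ContinuousLinearMap.lsmul ℝ ℝ (E := E)) hT.le
      (φ := deriv φ) (ψ := u') (hd.integrableOn_Ioc) hu'.integrableOn_Ioc
    -- The boundary term vanishes because φ is the primitive of its derivative and φ(T) = 0.
    rw [← hφ.deriv_eq T, hφT] at key
    simp only [ContinuousLinearMap.lsmul_apply, zero_smul, ← hφ.deriv_eq] at key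
    rw [h1, integral_Ioo_eq_intervalIntegral hT, integral_Ioo_eq_intervalIntegral hT,
      intervalIntegral.integral_add, intervalIntegral.integral_smul_const, ← hφ.deriv_eq T, hφT,
      zero_smul, zero_add, eq_neg_of_add_eq_zero_left key]
    · exact (hd.smul continuous_const).intervalIntegrable _ _
    · exact (hc.mono (by rw [uIcc_of_le hT.le])).intervalIntegrable

/-- The test functions on `(0,T)` with mean zero are the derivatives of test functions. -/
theorem isTestFunction_primitive {T : ℝ} (hT : 0 < T) {φ : ℝ → ℝ}
    (hφ : IsTestFunction (Ioo 0 T) φ) (h0 : ∫ s in (0:ℝ)..T, φ s = 0) :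
    IsTestFunction (Ioo 0 T) (fun t => ∫ s in (0:ℝ)..t, φ s) ∧
      deriv (fun t => ∫ s in (0:ℝ)..t, φ s) = φ := by
  have hc : Continuous φ := hφ.smooth.continuous
  have hd : ∀ t, HasDerivAt (fun t => ∫ s in (0:ℝ)..t, φ s) (φ t) t := fun t =>
    intervalIntegral.integral_hasDerivAt_right (hc.intervalIntegrable _ _)
      (hc.stronglyMeasurableAtFilter _ _) hc.continuousAt
  have hderiv : deriv (fun t => ∫ s in (0:ℝ)..t, φ s) = φ := funext fun t => (hd t).deriv
  obtain ⟨a, b, ha, hab, hb, hs⟩ := exists_tsupport_subset_Icc hT hφ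
  have hz : ∀ s, s ∉ Icc a b → φ s = 0 := fun s hs' =>
    image_eq_zero_of_notMem_tsupport fun h => hs' (hs h)
  have hsupp : Function.support (fun t => ∫ s in (0:ℝ)..t, φ s) ⊆ Icc a b := by
    intro t ht
    by_contra hn
    apply ht
    rw [mem_Icc, not_and_or, not_le, not_le] at hn
    rcases hn with hn | hn
    · change ∫ s in (0:ℝ)..t, φ s = 0
      rw [intervalIntegral.integral_congr (g := fun _ => 0)]
      · simp
      · intro s hs'
        refine hz s fun h => ?_
        rw [uIcc, mem_Icc] at hs'
        have : s < a := hs'.2.trans_lt (max_lt ha hn)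
        exact absurd h.1 (not_le.mpr this)
    · change ∫ s in (0:ℝ)..t, φ s = 0
      -- Right of the support the primitive has already reached its total, which is zero by `h0`.
      have h2 : ∫ s in t..T, φ s = 0 := by
        rw [intervalIntegral.integral_congr (g := fun _ => 0)]
        · simp
        · intro s hs'
          refine hz s fun h => ?_
          rw [uIcc, mem_Icc] at hs'
          have : b < s := (lt_min hn hb).trans_le hs'.1
          exact absurd h.2 (not_le.mpr this)
      have h3 := intervalIntegral.integral_add_adjacent_intervals
        (hc.intervalIntegrable (μ := volume) 0 t) (hc.intervalIntegrable t T)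
      rw [h2, h0, add_zero] at h3
      exact h3
  have hts : tsupport (fun t => ∫ s in (0:ℝ)..t, φ s) ⊆ Icc a b :=
    closure_minimal hsupp isClosed_Icc
  refine ⟨⟨?_, ?_, ?_⟩, hderiv⟩
  · rw [contDiff_infty_iff_deriv, hderiv]
    exact ⟨fun t => (hd t).differentiableAt, hφ.smooth⟩
  · exact HasCompactSupport.of_support_subset_isCompact isCompact_Icc hsupp
  · exact hts.trans (Icc_subset_Ioo ha hb)

theorem IsTestFunction.sub_smul {X : Type*} [NormedAddCommGroup X] [NormedSpace ℝ X] {U : Set X}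
    {φ ψ : X → ℝ} (hφ : IsTestFunction U φ) (hψ : IsTestFunction U ψ) (c : ℝ) :
    IsTestFunction U (fun x => φ x - c * ψ x) := by
  have hcψ : HasCompactSupport (fun x => c * ψ x) := hψ.compact.mul_left
  refine ⟨hφ.smooth.sub (contDiff_const.mul hψ.smooth), hφ.compact.sub hcψ, ?_⟩
  have h1 : tsupport (fun x => φ x - c * ψ x) ⊆ tsupport φ ∪ tsupport ψ := by
    refine closure_minimal ?_ ((isClosed_tsupport _).union (isClosed_tsupport _))
    intro x hx
    by_contra hn
    simp only [mem_union, not_or] at hn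
    apply hx
    simp [image_eq_zero_of_notMem_tsupport hn.1, image_eq_zero_of_notMem_tsupport hn.2]
  exact h1.trans (union_subset hφ.support hψ.support)

theorem exists_testFunction_integral_eq_one {T : ℝ} (hT : 0 < T) :
    ∃ η : ℝ → ℝ, IsTestFunction (Ioo 0 T) η ∧ ∫ s in (0:ℝ)..T, η s = 1 := by
  let η : ContDiffBump (T / 2) := ⟨T / 8, T / 4, by positivity, by linarith⟩
  have hsub : tsupport (η.normed volume) ⊆ Ioo 0 T := by
    rw [η.tsupport_normed_eq, Real.closedBall_eq_Icc]
    refine Icc_subset_Ioo ?_ ?_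
    · change 0 < T / 2 - T / 4; linarith
    · change T / 2 + T / 4 < T; linarith
  refine ⟨η.normed volume, ⟨η.contDiff_normed, η.hasCompactSupport_normed, hsub⟩, ?_⟩
  rw [← integral_Ioo_eq_intervalIntegral hT, ← η.integral_normed (μ := volume)]
  exact setIntegral_eq_integral_of_forall_compl_eq_zero fun x hx =>
    image_eq_zero_of_notMem_tsupport fun h => hx (hsub h)

/-- The lemma of du Bois-Reymond. -/
theorem ae_eq_const_of_integral_deriv_smul_eq_zero [CompleteSpace E] {T : ℝ} (hT : 0 < T)
    {u : ℝ → E} (hu : MemL2 T u)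
    (h : ∀ φ : ℝ → ℝ, IsTestFunction (Ioo 0 T) φ → ∫ t in Ioo 0 T, deriv φ t • u t = 0) :
    ∃ x, ∀ᵐ t ∂(volume.restrict (Ioo 0 T)), u t = x := by
  obtain ⟨η, hη, hη1⟩ := exists_testFunction_integral_eq_one hT
  have hint : ∀ φ : ℝ → ℝ, IsTestFunction (Ioo 0 T) φ →
      Integrable (fun t => φ t • u t) (volume.restrict (Ioo 0 T)) := by
    exact fun φ hφ => hu.integrable_smul hφ.smooth.continuous hφ.compact
  refine ⟨∫ t in Ioo 0 T, η t • u t, ?_⟩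
  set x := ∫ t in Ioo 0 T, η t • u t with hx
  have hloc : LocallyIntegrableOn (fun t => u t - x) (Ioo 0 T) volume := by
    refine IntegrableOn.locallyIntegrableOn ?_
    exact (MemLp.integrable one_le_two hu).sub (integrable_const x)
  have key := isOpen_Ioo.ae_eq_zero_of_integral_contDiff_smul_eq_zero (μ := volume) hloc ?_
  · rw [ae_restrict_iff' measurableSet_Ioo]
    filter_upwards [key] with t ht ht'
    exact sub_eq_zero.mp (ht ht')
  intro g hg1 hg2 hg3
  have hg : IsTestFunction (Ioo 0 T) g := ⟨hg1, hg2, hg3⟩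
  set c := ∫ s in (0:ℝ)..T, g s with hc
  -- Subtracting c η makes the mean zero, so the difference is the derivative of a test function and
  -- the hypothesis applies to it.
  have hd := hg.sub_smul hη c
  have hd0 : ∫ s in (0:ℝ)..T, (g s - c * η s) = 0 := by
    have hi : IntervalIntegrable (fun s => c * η s) volume 0 T :=
      (continuous_const.mul hη.smooth.continuous).intervalIntegrable _ _
    rw [intervalIntegral.integral_sub (hg1.continuous.intervalIntegrable _ _) hi,
      intervalIntegral.integral_const_mul, hη1, mul_one, hc, sub_self]
  obtain ⟨h1, h2⟩ := isTestFunction_primitive hT hd hd0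
  have h3 := h _ h1
  rw [h2] at h3
  rw [← setIntegral_eq_integral_of_forall_compl_eq_zero (s := Ioo 0 T) fun t ht => by
    rw [image_eq_zero_of_notMem_tsupport fun h => ht (hg3 h), zero_smul]]
  have e1 : ∫ t in Ioo 0 T, g t • (u t - x) = (∫ t in Ioo 0 T, g t • u t) - c • x := by
    simp only [smul_sub]
    rw [integral_sub (hint g hg), integral_smul_const, integral_Ioo_eq_intervalIntegral hT g]
    exact (hg1.continuous.integrableOn_Icc.mono_set Ioo_subset_Icc_self).smul_const x
  have e2 : ∫ t in Ioo 0 T, (g t - c * η t) • u t = (∫ t in Ioo 0 T, g t • u t) - c • x := by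
    simp only [sub_smul, mul_smul]
    have hi : Integrable (fun t => c • η t • u t) (volume.restrict (Ioo 0 T)) :=
      (hint η hη).smul c
    rw [integral_sub (hint g hg) hi, integral_smul]
  rw [e1, ← e2, h3]

/-- The primitive of u' has the same weak derivative as u, so by du Bois-Reymond their difference is
constant. -/
theorem HasWeakTimeDeriv.exists_ae_eq_primitive [CompleteSpace E] {T : ℝ} (hT : 0 < T)
    {u u' : ℝ → E} (h : HasWeakTimeDeriv T u u') :
    ∃ x, ∀ᵐ t ∂(volume.restrict (Ioo 0 T)), u t = x + ∫ s in (0:ℝ)..t, u' s := by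
  have hp := hasWeakTimeDeriv_of_primitive hT (u := fun t => (0 : E) + ∫ s in (0:ℝ)..t, u' s) 0
    h.memL2_deriv (Eventually.of_forall fun _ => rfl)
  have hk : ∀ φ : ℝ → ℝ, IsTestFunction (Ioo 0 T) φ →
      ∫ t in Ioo 0 T, deriv φ t • (u t - ((0 : E) + ∫ s in (0:ℝ)..t, u' s)) = 0 := by
    intro φ hφ
    have hd : Continuous (deriv φ) := hφ.smooth.continuous_deriv (by simp)
    simp only [smul_sub]
    rw [integral_sub (h.memL2.integrable_smul hd hφ.compact.deriv)
      (hp.memL2.integrable_smul hd hφ.compact.deriv), h.weak φ hφ, hp.weak φ hφ, sub_self]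
  obtain ⟨x, hx⟩ := ae_eq_const_of_integral_deriv_smul_eq_zero hT (h.memL2.sub hp.memL2) hk
  refine ⟨x, ?_⟩
  filter_upwards [hx] with t ht
  simp [← ht]

/-- Continuous representatives that agree almost everywhere agree on the open interval, hence on its
closure. So the initial value may be read off from any of them. -/
theorem HasInitialValue.eq_of_ae_eq {X : Type*} [NormedAddCommGroup X] {T : ℝ} (hT : 0 < T)
    {u v : ℝ → X} {x : X}
    (h : HasInitialValue T u x) (hv : ContinuousOn v (Icc 0 T))
    (huv : ∀ᵐ t ∂(volume.restrict (Ioo 0 T)), u t = v t) : v 0 = x := by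
  obtain ⟨c, hc, hcu, rfl⟩ := h
  have h1 : EqOn c v (Ioo 0 T) := by
    refine Measure.eqOn_open_of_ae_eq (μ := volume) ?_ isOpen_Ioo (hc.mono Ioo_subset_Icc_self)
      (hv.mono Ioo_subset_Icc_self)
    filter_upwards [hcu, huv] with t h1 h2
    rw [h1, h2]
  have h2 : EqOn c v (Icc 0 T) :=
    h1.of_subset_closure hc hv Ioo_subset_Icc_self (by rw [closure_Ioo hT.ne])
  exact (h2 (left_mem_Icc.mpr hT.le)).symm

theorem HasWeakTimeDeriv.ae_eq_primitive [CompleteSpace E] {T : ℝ} (hT : 0 < T)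
    {u u' : ℝ → E} {x : E} (h : HasWeakTimeDeriv T u u') (hx : HasInitialValue T u x) :
    ∀ᵐ t ∂(volume.restrict (Ioo 0 T)), u t = x + ∫ s in (0:ℝ)..t, u' s := by
  obtain ⟨z, hz⟩ := h.exists_ae_eq_primitive hT
  have h1 := hx.eq_of_ae_eq hT
    (continuousOn_const.add (continuousOn_primitive h.memL2_deriv)) hz
  have h2 : z = x := by simpa using h1
  rwa [← h2]

end Primitive

/-! ### The energy form of a Hilbert space embedding -/

section Energy

open scoped InnerProductSpace

variable {V H : Type*} [NormedAddCommGroup V] [InnerProductSpace ℝ V]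
  [NormedAddCommGroup H] [InnerProductSpace ℝ H]

/-- For `ι : V → H`, the bilinear form `(u, v)_V - (ι u, ι v)_H`. -/
def energy (ι : V →L[ℝ] H) : V →L[ℝ] V →L[ℝ] ℝ :=
  innerSL ℝ - (innerSL ℝ).bilinearComp ι ι

variable (ι : V →L[ℝ] H)

theorem energy_apply (u v : V) : energy ι u v = ⟪u, v⟫_ℝ - ⟪ι u, ι v⟫_ℝ := rfl

theorem energy_comm (u v : V) : energy ι u v = energy ι v u := by
  simp only [energy_apply, real_inner_comm]

variable {ι}

theorem energy_self_nonneg (hι : ∀ v, ‖ι v‖ ≤ ‖v‖) (v : V) : 0 ≤ energy ι v v := by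
  rw [energy_apply, real_inner_self_eq_norm_sq, real_inner_self_eq_norm_sq, sub_nonneg]
  exact pow_le_pow_left₀ (norm_nonneg _) (hι v) 2

/-- Cauchy–Schwarz for a form that is only known to be positive semidefinite, from the discriminant
of r ↦ energy(u + r v). -/
theorem energy_sq_le (hι : ∀ v, ‖ι v‖ ≤ ‖v‖) (u v : V) :
    energy ι u v ^ 2 ≤ energy ι u u * energy ι v v := by
  have h : ∀ r : ℝ, 0 ≤ energy ι v v * (r * r) + (2 * energy ι u v) * r + energy ι u u := by
    intro r
    have := energy_self_nonneg hι (u + r • v)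
    simp only [map_add, map_smul, add_apply, smul_apply,
      smul_eq_mul, energy_comm ι v u] at this
    linarith
  have := discrim_le_zero h
  rw [discrim] at this
  linarith

variable [CompleteSpace V] [CompleteSpace H]

/-- In operator terms A ι* = 1 - R with R = ι ι*, that is, R = (1 + A)⁻¹. This replaces the
unbounded A by bounded operators. -/
theorem energy_adjoint (h : H) (v : V) :
    energy ι (ι.adjoint h) v = ⟪h - ι (ι.adjoint h), ι v⟫_ℝ := by
  rw [energy_apply, ContinuousLinearMap.adjoint_inner_left, inner_sub_left]

end Energy

/-- A linear equation `(x, S d) = ℓ d` is solvable if `ℓ` is bounded by a multiple of `‖S ·‖`. -/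
theorem exists_inner_eq_of_abs_le {D K : Type*} [AddCommGroup D] [Module ℝ D]
    [NormedAddCommGroup K] [InnerProductSpace ℝ K] [CompleteSpace K] (S : D →ₗ[ℝ] K)
    (ℓ : D →ₗ[ℝ] ℝ) (C : ℝ) (h : ∀ d, |ℓ d| ≤ C * ‖S d‖) :
    ∃ x : K, ∀ d, ℓ d = inner ℝ x (S d) := by
  -- A purely algebraic section of S suffices. The bound on ℓ makes the induced functional on the
  -- range continuous, and it shows that ℓ vanishes on the kernel of S.
  obtain ⟨g, hg⟩ := S.rangeRestrict.exists_rightInverse_of_surjective S.range_rangeRestrict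
  have hg' : ∀ r : S.range, S (g r) = r := fun r =>
    congrArg Subtype.val (LinearMap.congr_fun hg r)
  let L : StrongDual ℝ S.range := (ℓ.comp g).mkContinuous C fun r => by
    have := h (g r)
    rwa [hg'] at this
  obtain ⟨M, hM, -⟩ := exists_extension_norm_eq S.range L
  refine ⟨(InnerProductSpace.toDual ℝ K).symm M, fun d => ?_⟩
  rw [InnerProductSpace.toDual_symm_apply]
  have h1 : M (S d) = ℓ (g ⟨S d, LinearMap.mem_range_self S d⟩) :=
    hM ⟨S d, LinearMap.mem_range_self S d⟩
  rw [h1, ← sub_eq_zero, ← map_sub]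
  have h2 := h (d - g ⟨S d, LinearMap.mem_range_self S d⟩)
  rw [map_sub S, hg', sub_self, norm_zero, mul_zero] at h2
  exact abs_nonpos_iff.mp h2

/-! ### Maximal regularity -/

section Regularity

open scoped InnerProductSpace

variable {V H : Type*} [NormedAddCommGroup V] [InnerProductSpace ℝ V]
  [NormedAddCommGroup H] [InnerProductSpace ℝ H] {ι : V →L[ℝ] H}

theorem MemL2.clm_comp {X Y : Type*} [NormedAddCommGroup X] [NormedSpace ℝ X]
    [NormedAddCommGroup Y] [NormedSpace ℝ Y] {T : ℝ} {u : ℝ → X} (hu : MemL2 T u)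
    (L : X →L[ℝ] Y) : MemL2 T (fun t => L (u t)) :=
  L.comp_memLp' hu

theorem hasDerivAt_integral_left [CompleteSpace H] {ψ : ℝ → H} (hψ : Continuous ψ) (T t : ℝ) :
    HasDerivAt (fun t => ∫ s in t..T, ψ s) (-ψ t) t :=
  intervalIntegral.integral_hasDerivAt_left (hψ.intervalIntegrable _ _)
    (hψ.stronglyMeasurableAtFilter _ _) hψ.continuousAt

variable [CompleteSpace V] [CompleteSpace H]

/-- The energy identity for the adjoint problem. -/
theorem integral_adjoint_energy {T : ℝ} {ψ : ℝ → H} (hψ : Continuous ψ) :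
    ∫ t in (0:ℝ)..T, ⟪(∫ s in t..T, ψ s) - ι (ι.adjoint (∫ s in t..T, ψ s)),
        ι (ι.adjoint (ψ t))⟫_ℝ
      = energy ι (ι.adjoint (∫ s in (0:ℝ)..T, ψ s)) (ι.adjoint (∫ s in (0:ℝ)..T, ψ s)) / 2 := by
  have hΦ : Continuous fun t => ∫ s in t..T, ψ s :=
    continuous_iff_continuousAt.mpr fun t => (hasDerivAt_integral_left hψ T t).continuousAt
  -- The integrand is -1/2 times the derivative of the energy of ι* ∫_t^T ψ, which vanishes at t =
  -- T.
  have hd : ∀ t, HasDerivAt (fun t => energy ι (ι.adjoint (∫ s in t..T, ψ s))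
      (ι.adjoint (∫ s in t..T, ψ s))) (-2 * ⟪(∫ s in t..T, ψ s)
        - ι (ι.adjoint (∫ s in t..T, ψ s)), ι (ι.adjoint (ψ t))⟫_ℝ) t := by
    intro t
    have h1 := ι.adjoint.hasFDerivAt.comp_hasDerivAt t (hasDerivAt_integral_left hψ T t)
    have h2 := (energy ι).hasFDerivAt.comp_hasDerivAt t h1
    have h3 := h2.clm_apply h1
    refine h3.congr_deriv ?_
    simp only [Function.comp_apply, map_neg, neg_apply]
    rw [energy_comm, energy_adjoint]
    ring
  have h := intervalIntegral.integral_eq_sub_of_hasDerivAt (a := 0) (b := T)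
    (fun t _ => hd t) (Continuous.intervalIntegrable (by fun_prop) _ _)
  rw [intervalIntegral.integral_const_mul, intervalIntegral.integral_same] at h
  simp only [map_zero] at h
  linarith

end Regularity

/-! ### Existence of strong solutions by duality -/

section StrongSolution

open scoped InnerProductSpace

variable {V H : Type*} [NormedAddCommGroup V] [InnerProductSpace ℝ V]
  [NormedAddCommGroup H] [InnerProductSpace ℝ H] {ι : V →L[ℝ] H}

theorem MemL2.integrable_inner {T : ℝ} {u v : ℝ → H} (hu : MemL2 T u) (hv : MemL2 T v) :
    Integrable (fun t => ⟪u t, v t⟫_ℝ) (volume.restrict (Ioo 0 T)) := by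
  refine (L2.integrable_inner (𝕜 := ℝ) (MemLp.toLp u hu) (MemLp.toLp v hv)).congr ?_
  filter_upwards [MemLp.coeFn_toLp hu, MemLp.coeFn_toLp hv] with t h1 h2
  rw [h1, h2]

/-- Continuous functions as elements of `L²(I, H)`. -/
def contToL2 (H : Type*) [NormedAddCommGroup H] [NormedSpace ℝ H] (T : ℝ) :
    C(ℝ, H) →ₗ[ℝ] Lp H 2 (volume.restrict (Ioo (0 : ℝ) T)) where
  toFun ψ := MemLp.toLp ψ (memL2_of_continuousOn ψ.continuous.continuousOn)
  map_add' ψ χ := MemLp.toLp_add (memL2_of_continuousOn ψ.continuous.continuousOn)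
    (memL2_of_continuousOn χ.continuous.continuousOn)
  map_smul' c ψ := MemLp.toLp_const_smul c (memL2_of_continuousOn ψ.continuous.continuousOn)

theorem inner_contToL2 {T : ℝ} (x : Lp H 2 (volume.restrict (Ioo (0 : ℝ) T))) (ψ : C(ℝ, H)) :
    ⟪x, contToL2 H T ψ⟫_ℝ = ∫ t in Ioo 0 T, ⟪x t, ψ t⟫_ℝ := by
  rw [L2.inner_def]
  refine integral_congr_ae ?_
  filter_upwards [MemLp.coeFn_toLp (memL2_of_continuousOn (T := T) ψ.continuous.continuousOn)]
    with t ht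
  exact congrArg _ ht

variable [CompleteSpace H]

/-- The backward primitive `t ↦ ∫_t^T ψ`. -/
def backwardPrimitive (H : Type*) [NormedAddCommGroup H] [InnerProductSpace ℝ H] [CompleteSpace H]
    (T : ℝ) : C(ℝ, H) →ₗ[ℝ] C(ℝ, H) where
  toFun ψ := ⟨fun t => ∫ s in t..T, ψ s, continuous_iff_continuousAt.mpr fun t =>
    (hasDerivAt_integral_left ψ.continuous T t).continuousAt⟩
  map_add' ψ χ := by
    ext t
    exact intervalIntegral.integral_add (ψ.continuous.intervalIntegrable _ _)
      (χ.continuous.intervalIntegrable _ _)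
  map_smul' c ψ := by
    ext t
    exact intervalIntegral.integral_smul c _

variable [CompleteSpace V]

/-- Existence of a very weak solution of the problem for the time derivative. -/
theorem exists_very_weak_solution {T : ℝ} (hT : 0 < T) (hι : ∀ v, ‖ι v‖ ≤ ‖v‖)
    (g : Lp H 2 (volume.restrict (Ioo (0 : ℝ) T))) (w₀ : V) :
    ∃ x : Lp H 2 (volume.restrict (Ioo (0 : ℝ) T)), ∀ ψ : C(ℝ, H),
      (∫ t in Ioo 0 T, ⟪g t, ι (ι.adjoint (ψ t))⟫_ℝ)
          - energy ι w₀ (ι.adjoint (∫ s in (0:ℝ)..T, ψ s))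
        = ∫ t in Ioo 0 T, ⟪x t, ι (ι.adjoint (ψ t)) + ((∫ s in t..T, ψ s)
            - ι (ι.adjoint (∫ s in t..T, ψ s)))⟫_ℝ := by
  -- With Φ(t) = ∫_t^T ψ, S ψ = R ψ + (1 - R) Φ is the adjoint parabolic operator -∂_t + A applied
  -- to R Φ, which vanishes at T.
  let R : H →L[ℝ] H := ι.comp ι.adjoint
  let P : C(ℝ, H) →ₗ[ℝ] C(ℝ, H) := R.compLeftContinuous ℝ ℝ
  let S : C(ℝ, H) →ₗ[ℝ] C(ℝ, H) :=
    P + (backwardPrimitive H T - P.comp (backwardPrimitive H T))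
  let r := (contToL2 H T).comp P
  let ℓ : C(ℝ, H) →ₗ[ℝ] ℝ := (innerSL ℝ g).toLinearMap.comp r
    - (energy ι w₀).toLinearMap.comp (ι.adjoint.toLinearMap.comp
        ((ContinuousMap.evalCLM ℝ (0:ℝ)).toLinearMap.comp (backwardPrimitive H T)))
  have hℓ : ∀ ψ, ℓ ψ = ⟪g, r ψ⟫_ℝ - energy ι w₀ (ι.adjoint (∫ s in (0:ℝ)..T, ψ s)) :=
    fun ψ => rfl
  have hbound : ∀ ψ, |ℓ ψ| ≤ (‖g‖ + 2 * √(energy ι w₀ w₀)) * ‖((contToL2 H T).comp S) ψ‖ := by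
    intro ψ
    set N := ‖((contToL2 H T).comp S) ψ‖ with hN
    set q := energy ι (ι.adjoint (∫ s in (0:ℝ)..T, ψ s)) (ι.adjoint (∫ s in (0:ℝ)..T, ψ s))
      with hq
    have hq0 : 0 ≤ q := energy_self_nonneg hι _
    -- Pairing S ψ with R ψ gives coercivity: it controls both R ψ and the energy q at time 0, the
    -- two quantities through which ψ enters the data ℓ.
    have hid : ⟪r ψ, ((contToL2 H T).comp S) ψ⟫_ℝ = ‖r ψ‖ ^ 2 + q / 2 := by
      have h1 : ((contToL2 H T).comp S) ψ = r ψ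
          + contToL2 H T ((backwardPrimitive H T - P.comp (backwardPrimitive H T)) ψ) := by
        exact map_add (contToL2 H T) (P ψ) _
      rw [h1, inner_add_right, real_inner_self_eq_norm_sq, real_inner_comm]
      congr 1
      change ⟪_, contToL2 H T (P ψ)⟫_ℝ = _
      rw [inner_contToL2, hq, ← integral_adjoint_energy ψ.continuous,
        ← integral_Ioo_eq_intervalIntegral hT]
      refine integral_congr_ae ?_
      filter_upwards [MemLp.coeFn_toLp (memL2_of_continuousOn (T := T) ((backwardPrimitive H T
        - P.comp (backwardPrimitive H T)) ψ).continuous.continuousOn)] with t ht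
      exact congrArg (fun z => ⟪z, P ψ t⟫_ℝ) ht
    have hle : ‖r ψ‖ ^ 2 + q / 2 ≤ ‖r ψ‖ * N := hid ▸ real_inner_le_norm _ _
    have hr : ‖r ψ‖ ≤ N := by
      by_contra hlt
      rw [not_le] at hlt
      nlinarith [norm_nonneg (r ψ), norm_nonneg (((contToL2 H T).comp S) ψ)]
    have hN0 : 0 ≤ N := norm_nonneg _
    have hqN : √q ≤ 2 * N := by
      rw [Real.sqrt_le_left (by positivity)]
      nlinarith [norm_nonneg (r ψ)]
    have he : |energy ι w₀ (ι.adjoint (∫ s in (0:ℝ)..T, ψ s))| ≤ √(energy ι w₀ w₀) * √q := by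
      rw [← Real.sqrt_mul (energy_self_nonneg hι _)]
      exact Real.abs_le_sqrt (energy_sq_le hι _ _)
    rw [hℓ]
    calc |⟪g, r ψ⟫_ℝ - energy ι w₀ (ι.adjoint (∫ s in (0:ℝ)..T, ψ s))|
        ≤ |⟪g, r ψ⟫_ℝ| + |energy ι w₀ (ι.adjoint (∫ s in (0:ℝ)..T, ψ s))| := abs_sub _ _
      _ ≤ ‖g‖ * ‖r ψ‖ + √(energy ι w₀ w₀) * √q := add_le_add (abs_real_inner_le_norm _ _) he
      _ ≤ ‖g‖ * N + √(energy ι w₀ w₀) * (2 * N) := by gcongr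
      _ = _ := by ring
  obtain ⟨x, hx⟩ := exists_inner_eq_of_abs_le ((contToL2 H T).comp S) ℓ _ hbound
  refine ⟨x, fun ψ => ?_⟩
  have h := hx ψ
  rw [hℓ] at h
  change ⟪g, contToL2 H T (P ψ)⟫_ℝ - _ = ⟪x, contToL2 H T (S ψ)⟫_ℝ at h
  rw [inner_contToL2, inner_contToL2] at h
  exact h

/-- The adjoint of the backward primitive is the forward primitive. This turns the very weak
identity for x into an equation for w = w₀ + ∫ x. -/
theorem integral_inner_backward {T : ℝ} (hT : 0 < T) {x ψ : ℝ → H} (hx : MemL2 T x)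
    (hψ : Continuous ψ) (Q : H →L[ℝ] H) :
    ∫ t in Ioo 0 T, ⟪x t, Q (∫ s in t..T, ψ s)⟫_ℝ
      = ∫ t in Ioo 0 T, ⟪∫ s in (0:ℝ)..t, x s, Q (ψ t)⟫_ℝ := by
  have hψi : ∀ a b, IntervalIntegrable ψ volume a b := fun a b => hψ.intervalIntegrable a b
  have hψL : MemL2 T ψ := memL2_of_continuousOn hψ.continuousOn
  have hΨ : MemL2 T (fun t => Q (∫ s in (0:ℝ)..t, ψ s)) :=
    (memL2_of_continuousOn (continuousOn_primitive hψL)).clm_comp Q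
  have key := integral_bilin_primitive_add ((innerSL ℝ).bilinearComp (.id ℝ H) Q) hT.le
    hx.integrableOn_Ioc hψL.integrableOn_Ioc
  simp only [ContinuousLinearMap.bilinearComp_apply, innerSL_apply_apply,
    ContinuousLinearMap.id_apply] at key
  rw [← integral_Ioo_eq_intervalIntegral hT, ← integral_Ioo_eq_intervalIntegral hT] at key
  have h1 : ∀ t, Q (∫ s in t..T, ψ s) = Q (∫ s in (0:ℝ)..T, ψ s) - Q (∫ s in (0:ℝ)..t, ψ s) := by
    intro t
    rw [← map_sub, intervalIntegral.integral_interval_sub_left (hψi _ _) (hψi _ _)]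
  have hc : MemL2 T fun _ => Q (∫ s in (0:ℝ)..T, ψ s) := memL2_of_continuousOn continuousOn_const
  have h2 : ∫ t in Ioo 0 T, ⟪x t, Q (∫ s in (0:ℝ)..T, ψ s)⟫_ℝ
      = ⟪∫ s in (0:ℝ)..T, x s, Q (∫ s in (0:ℝ)..T, ψ s)⟫_ℝ := by
    rw [← integral_Ioo_eq_intervalIntegral hT x, real_inner_comm,
      ← integral_inner (MemLp.integrable one_le_two hx)]
    simp only [real_inner_comm]
  have h3 : ∫ t in Ioo 0 T, ⟪x t, Q (∫ s in t..T, ψ s)⟫_ℝ = ∫ t in Ioo 0 T,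
      (⟪x t, Q (∫ s in (0:ℝ)..T, ψ s)⟫_ℝ - ⟪x t, Q (∫ s in (0:ℝ)..t, ψ s)⟫_ℝ) :=
    integral_congr_ae (Eventually.of_forall fun t => by
      change ⟪x t, Q (∫ s in t..T, ψ s)⟫_ℝ = _
      rw [h1 t, inner_sub_right])
  rw [h3, integral_sub (hx.integrable_inner hc) (hx.integrable_inner hΨ), h2, ← key]
  ring

/-- Maximal regularity: the problem `w' + A w = g`, `w(0) = w₀ ∈ V` has a solution with
`w' ∈ L²(I, H)`, where `A` is the operator induced by the form `energy ι`. -/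
theorem exists_strong_solution {T : ℝ} (hT : 0 < T) (hι : ∀ v, ‖ι v‖ ≤ ‖v‖) {g : ℝ → H}
    (hg : MemL2 T g) (w₀ : V) :
    ∃ (x : ℝ → H) (W : ℝ → V), MemL2 T x ∧ MemL2 T W ∧
      (∀ᵐ t ∂(volume.restrict (Ioo 0 T)), ι (W t) = ι w₀ + ∫ s in (0:ℝ)..t, x s) ∧
      ∀ᵐ t ∂(volume.restrict (Ioo 0 T)), ∀ v, energy ι (W t) v = ⟪g t - x t, ι v⟫_ℝ := by
  obtain ⟨x, hx⟩ := exists_very_weak_solution hT hι (MemLp.toLp g hg) w₀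
  have hxL : MemL2 T x := Lp.memLp x
  set w : ℝ → H := fun t => ι w₀ + ∫ s in (0:ℝ)..t, x s with hw
  have hwc : ContinuousOn w (Icc 0 T) := continuousOn_const.add (continuousOn_primitive hxL)
  have hwL : MemL2 T w := memL2_of_continuousOn hwc
  let R : H →L[ℝ] H := ι.comp ι.adjoint
  have hR : ∀ a b : H, ⟪R a, b⟫_ℝ = ⟪a, R b⟫_ℝ := fun a b => by
    change ⟪ι (ι.adjoint a), b⟫_ℝ = ⟪a, ι (ι.adjoint b)⟫_ℝ
    rw [← ContinuousLinearMap.adjoint_inner_right, ContinuousLinearMap.adjoint_inner_left]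
  -- G is the residual g - w' - A w after applying R. Since R A = 1 - R, it makes sense without
  -- knowing that w takes values in V.
  set G : ℝ → H := fun t => R (g t) - R (x t) - (w t - R (w t)) with hG
  have hGL : MemL2 T G :=
    ((hg.clm_comp R).sub (hxL.clm_comp R)).sub (hwL.sub (hwL.clm_comp R))
  have hG0 : ∀ᵐ t ∂volume, t ∈ Ioo 0 T → G t = 0 := by
    refine isOpen_Ioo.ae_eq_zero_of_integral_contDiff_smul_eq_zero
      (IntegrableOn.locallyIntegrableOn (MemLp.integrable one_le_two hGL)) ?_
    intro η hη1 hη2 hη3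
    rw [← setIntegral_eq_integral_of_forall_compl_eq_zero (s := Ioo 0 T) fun t ht => by
      rw [image_eq_zero_of_notMem_tsupport fun h => ht (hη3 h), zero_smul]]
    refine ext_inner_right ℝ fun h => ?_
    have hηc := hη1.continuous
    -- Products of a scalar test function and a fixed vector suffice to conclude G = 0.
    let ψ : C(ℝ, H) := ⟨fun t => η t • h, hηc.smul continuous_const⟩
    have key := hx ψ
    have hQ := integral_inner_backward hT hxL ψ.continuous (.id ℝ H - R)
    let Q : H →L[ℝ] H := .id ℝ H - R
    have hψL : MemL2 T ψ := memL2_of_continuousOn ψ.continuous.continuousOn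
    have hΦL : MemL2 T (fun t => Q (∫ s in t..T, ψ s)) :=
      (memL2_of_continuousOn (backwardPrimitive H T ψ).continuous.continuousOn).clm_comp Q
    have hKL : MemL2 T (fun t => ∫ s in (0:ℝ)..t, x s) :=
      memL2_of_continuousOn (continuousOn_primitive hxL)
    have hcL : MemL2 T (fun _ => ι w₀) := memL2_of_continuousOn continuousOn_const
    have e1 : ∫ t in Ioo 0 T, ⟪(MemLp.toLp g hg : ℝ → H) t, ι (ι.adjoint (ψ t))⟫_ℝ
        = ∫ t in Ioo 0 T, ⟪g t, R (ψ t)⟫_ℝ := by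
      refine integral_congr_ae ?_
      filter_upwards [MemLp.coeFn_toLp hg] with t ht
      rw [ht]; rfl
    have e2 : energy ι w₀ (ι.adjoint (∫ s in (0:ℝ)..T, ψ s))
        = ∫ t in Ioo 0 T, ⟪ι w₀, Q (ψ t)⟫_ℝ := by
      rw [integral_inner (MemLp.integrable one_le_two (hψL.clm_comp Q)),
        ContinuousLinearMap.integral_comp_comm _ (MemLp.integrable one_le_two hψL),
        integral_Ioo_eq_intervalIntegral hT, energy_comm, energy_adjoint, real_inner_comm]
      rfl
    have e3 : ∫ t in Ioo 0 T, ⟪x t, ι (ι.adjoint (ψ t)) + ((∫ s in t..T, ψ s)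
        - ι (ι.adjoint (∫ s in t..T, ψ s)))⟫_ℝ = (∫ t in Ioo 0 T, ⟪x t, R (ψ t)⟫_ℝ)
          + ∫ t in Ioo 0 T, ⟪∫ s in (0:ℝ)..t, x s, Q (ψ t)⟫_ℝ := by
      simp only [inner_add_right]
      rw [← hQ]
      exact integral_add (hxL.integrable_inner (hψL.clm_comp R)) (hxL.integrable_inner hΦL)
    rw [e1, e2, e3] at key
    have e4 : ∫ t in Ioo 0 T, ⟪h, η t • G t⟫_ℝ = (∫ t in Ioo 0 T, ⟪g t, R (ψ t)⟫_ℝ)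
        - (∫ t in Ioo 0 T, ⟪ι w₀, Q (ψ t)⟫_ℝ) - ((∫ t in Ioo 0 T, ⟪x t, R (ψ t)⟫_ℝ)
          + ∫ t in Ioo 0 T, ⟪∫ s in (0:ℝ)..t, x s, Q (ψ t)⟫_ℝ) := by
      have i1 := hg.integrable_inner (hψL.clm_comp R)
      have i2 := hcL.integrable_inner (hψL.clm_comp Q)
      have i3 := hxL.integrable_inner (hψL.clm_comp R)
      have i4 := hKL.integrable_inner (hψL.clm_comp Q)
      rw [← integral_sub i1 i2, ← integral_add i3 i4,
        ← integral_sub (by exact i1.sub i2) (by exact i3.add i4)]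
      refine integral_congr_ae (Eventually.of_forall fun t => ?_)
      have hQ' : Q (ψ t) = η t • (h - R h) := by
        change η t • h - R (η t • h) = _
        rw [map_smul, smul_sub]
      have hR' : R (ψ t) = η t • R h := map_smul R _ _
      have e5 : ⟪h, η t • G t⟫_ℝ = η t * ⟪G t, h⟫_ℝ := by
        rw [inner_smul_right, real_inner_comm]
      simp only [e5]
      simp only [hQ', hR', inner_smul_right, hG, hw, inner_sub_right, inner_sub_left,
        inner_add_left, hR, map_add]
      ring
    have hGη : Integrable (fun t => η t • G t) (volume.restrict (Ioo 0 T)) :=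
      hGL.integrable_smul hηc hη2
    rw [inner_zero_left, real_inner_comm, ← integral_inner hGη, e4, key, sub_self]
  have hfix : ∀ᵐ t ∂(volume.restrict (Ioo 0 T)), R (g t - x t + w t) = w t := by
    rw [ae_restrict_iff' measurableSet_Ioo]
    filter_upwards [hG0] with t ht ht'
    rw [map_add, map_sub, ← sub_eq_zero, ← ht ht']
    simp only [hG]
    abel
  -- G = 0 reads w = R(g - x + w). So w lifts to V through ι*, and `energy_adjoint` returns the
  -- equation.
  refine ⟨x, fun t => ι.adjoint (g t - x t + w t), hxL,
    MemL2.clm_comp (u := fun t => g t - x t + w t) ((hg.sub hxL).add hwL) ι.adjoint, ?_, ?_⟩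
  · filter_upwards [hfix] with t ht using ht
  · filter_upwards [hfix] with t ht v
    rw [energy_adjoint]
    change ⟪g t - x t + w t - R (g t - x t + w t), ι v⟫_ℝ = _
    rw [ht, add_sub_cancel_right]

end StrongSolution

/-! ### Time-regular solutions and uniqueness -/

section Regular

open scoped InnerProductSpace

variable {V H : Type*} [NormedAddCommGroup V] [InnerProductSpace ℝ V]
  [NormedAddCommGroup H] [InnerProductSpace ℝ H] {ι : V →L[ℝ] H}
  [CompleteSpace V] [CompleteSpace H]

theorem intervalIntegral_congr_Ioo {X : Type*} [NormedAddCommGroup X] [NormedSpace ℝ X]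
    {T t : ℝ} (ht : t ∈ Icc 0 T) {u v : ℝ → X}
    (h : ∀ᵐ s ∂(volume.restrict (Ioo 0 T)), u s = v s) :
    ∫ s in (0:ℝ)..t, u s = ∫ s in (0:ℝ)..t, v s := by
  rw [intervalIntegral.integral_of_le ht.1, intervalIntegral.integral_of_le ht.1,
    integral_Ioc_eq_integral_Ioo, integral_Ioc_eq_integral_Ioo]
  exact integral_congr_ae (ae_restrict_of_ae_restrict_of_subset (Ioo_subset_Ioo_right ht.2) h)

/-- The regular solution: `w` is the time derivative of `Y` and `x` the one of `w`. -/
theorem exists_regular_solution {T : ℝ} (hT : 0 < T) (hι : ∀ v, ‖ι v‖ ≤ ‖v‖) {f' : ℝ → H}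
    (hf' : MemL2 T f') (f₀ κ κ' : V) (hκ : ∀ v, energy ι κ v = -⟪ι κ', ι v⟫_ℝ) :
    ∃ (x : ℝ → H) (Y : ℝ → V), MemL2 T x ∧ ContinuousOn Y (Icc 0 T) ∧
      (∀ t ∈ Icc 0 T, ι (Y t) = ι κ + ∫ s in (0:ℝ)..t, (ι (f₀ + κ') + ∫ r in (0:ℝ)..s, x r)) ∧
      ∀ t ∈ Icc 0 T, ∀ v, energy ι (Y t) v = ⟪(ι f₀ + ∫ s in (0:ℝ)..t, f' s)
        - (ι (f₀ + κ') + ∫ s in (0:ℝ)..t, x s), ι v⟫_ℝ := by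
  -- The time derivative of the solution starts from f(0) + Δκ, which lies in V by compatibility of
  -- the data.
  obtain ⟨x, W, hx, hW, hιW, hWe⟩ := exists_strong_solution hT hι hf' (f₀ + κ')
  have h0 : (0 : ℝ) ∈ Icc 0 T := left_mem_Icc.mpr hT.le
  refine ⟨x, fun t => κ + ∫ s in (0:ℝ)..t, W s, hx,
    continuousOn_const.add (continuousOn_primitive hW), fun t ht => ?_, fun t ht v => ?_⟩
  · rw [map_add, ← ContinuousLinearMap.intervalIntegral_comp_comm _ (hW.intervalIntegrable h0 ht),
      intervalIntegral_congr_Ioo ht hιW]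
  · have hxi := hx.intervalIntegrable h0 ht
    have hfi := hf'.intervalIntegrable h0 ht
    have h1 : energy ι (∫ s in (0:ℝ)..t, W s) v = ⟪∫ s in (0:ℝ)..t, (f' s - x s), ι v⟫_ℝ := by
      have e1 := ((energy ι).flip v).intervalIntegral_comp_comm (hW.intervalIntegrable h0 ht)
      have e2 := (innerSL ℝ (ι v)).intervalIntegral_comp_comm (hfi.sub hxi)
      rw [real_inner_comm]
      refine e1.symm.trans (Eq.trans ?_ e2)
      refine intervalIntegral_congr_Ioo ht ?_
      filter_upwards [hWe] with s hs
      exact (hs v).trans (real_inner_comm _ _)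
    rw [map_add, add_apply, hκ, h1, intervalIntegral.integral_sub hfi hxi]
    simp only [map_add, inner_add_left, inner_sub_left]
    ring

/-- Uniqueness for the time-integrated problem. -/
theorem ae_eq_zero_of_integrated_equation {T : ℝ} (hT : 0 < T) (hι : ∀ v, ‖ι v‖ ≤ ‖v‖)
    {u : ℝ → V} (hu : MemL2 T u)
    (h : ∀ᵐ t ∂(volume.restrict (Ioo 0 T)), ∀ v,
      ⟪ι (u t), ι v⟫_ℝ + energy ι (∫ s in (0:ℝ)..t, u s) v = 0) :
    ∀ᵐ t ∂(volume.restrict (Ioo 0 T)), ι (u t) = 0 := by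
  have hUc := continuousOn_primitive hu
  have hιu := hu.clm_comp ι
  have h0 : (0 : ℝ) ∈ Icc 0 T := left_mem_Icc.mpr hT.le
  -- Testing at time t with U(t) = ∫_0^t u gives ‖ι U(T)‖² / 2 + ∫ energy(U, U) = 0, where both
  -- terms are nonnegative.
  have key : (∫ t in (0:ℝ)..T, ⟪ι (u t), ∫ s in (0:ℝ)..t, ι (u s)⟫_ℝ)
        + (∫ t in (0:ℝ)..T, ⟪∫ s in (0:ℝ)..t, ι (u s), ι (u t)⟫_ℝ)
      = ⟪∫ s in (0:ℝ)..T, ι (u s), ∫ s in (0:ℝ)..T, ι (u s)⟫_ℝ :=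
    integral_bilin_primitive_add (innerSL ℝ : H →L[ℝ] H →L[ℝ] ℝ) hT.le
      hιu.integrableOn_Ioc hιu.integrableOn_Ioc
  have e1 : ∫ t in (0:ℝ)..T, ⟪∫ s in (0:ℝ)..t, ι (u s), ι (u t)⟫_ℝ
      = ∫ t in (0:ℝ)..T, ⟪ι (u t), ∫ s in (0:ℝ)..t, ι (u s)⟫_ℝ := by
    simp only [real_inner_comm]
  rw [e1, real_inner_self_eq_norm_sq] at key
  have e2 : ∫ t in (0:ℝ)..T, ⟪ι (u t), ∫ s in (0:ℝ)..t, ι (u s)⟫_ℝ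
      = ∫ t in Ioo 0 T, -energy ι (∫ s in (0:ℝ)..t, u s) (∫ s in (0:ℝ)..t, u s) := by
    rw [← integral_Ioo_eq_intervalIntegral hT]
    refine integral_congr_ae ?_
    filter_upwards [h, self_mem_ae_restrict measurableSet_Ioo] with t ht ht'
    rw [ι.intervalIntegral_comp_comm (hu.intervalIntegrable h0 (Ioo_subset_Icc_self ht'))]
    exact eq_neg_of_add_eq_zero_left (ht _)
  rw [e2, integral_neg] at key
  have hEc : ContinuousOn (fun t => energy ι (∫ s in (0:ℝ)..t, u s) (∫ s in (0:ℝ)..t, u s))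
      (Icc 0 T) := ((energy ι).continuous.comp_continuousOn hUc).clm_apply hUc
  have hE0 : ∫ t in Ioo 0 T, energy ι (∫ s in (0:ℝ)..t, u s) (∫ s in (0:ℝ)..t, u s) = 0 := by
    refine le_antisymm ?_ (integral_nonneg fun t => energy_self_nonneg hι _)
    have := sq_nonneg ‖∫ t in (0:ℝ)..T, ι (u t)‖
    linarith
  rw [integral_eq_zero_iff_of_nonneg (fun t => energy_self_nonneg hι _)
    (hEc.integrableOn_Icc.mono_set Ioo_subset_Icc_self)] at hE0
  filter_upwards [h, hE0] with t ht ht'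
  -- The energy may be degenerate, so U = 0 is not inferred. Cauchy–Schwarz still removes the energy
  -- term, and testing with u(t) leaves ‖ι u(t)‖² = 0.
  have h1 : energy ι (∫ s in (0:ℝ)..t, u s) (u t) = 0 := by
    have := energy_sq_le hι (∫ s in (0:ℝ)..t, u s) (u t)
    rw [show energy ι (∫ s in (0:ℝ)..t, u s) (∫ s in (0:ℝ)..t, u s) = 0 from ht', zero_mul] at this
    exact pow_eq_zero_iff two_ne_zero |>.mp (le_antisymm this (sq_nonneg _))
  have h2 := ht (u t)
  rw [h1, add_zero] at h2
  exact inner_self_eq_zero.mp h2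

end Regular

/-! ### Estimates on one subinterval -/

section Interval

open scoped InnerProductSpace

variable {V H : Type*} [NormedAddCommGroup V] [InnerProductSpace ℝ V]
  [NormedAddCommGroup H] [InnerProductSpace ℝ H] {ι : V →L[ℝ] H}

theorem MemL2.intervalIntegrable_norm_sq {X : Type*} [NormedAddCommGroup X] {T : ℝ} {u : ℝ → X}
    (hu : MemL2 T u) {a b : ℝ} (ha : a ∈ Icc 0 T) (hb : b ∈ Icc 0 T) :
    IntervalIntegrable (fun t => ‖u t‖ ^ 2) volume a b := by
  have h : Integrable (fun t => ‖u t‖ ^ 2) (volume.restrict (Ioo 0 T)) :=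
    MemLp.integrable_norm_pow hu two_ne_zero
  have h' : IntegrableOn (fun t => ‖u t‖ ^ 2) (Ioc 0 T) := by
    rwa [integrableOn_Ioc_iff_integrableOn_Ioo]
  rw [intervalIntegrable_iff]
  refine h'.mono_set fun s hs => ?_
  rw [mem_uIoc] at hs
  rcases hs with hs | hs
  · exact ⟨ha.1.trans_lt hs.1, hs.2.trans hb.2⟩
  · exact ⟨hb.1.trans_lt hs.1, hs.2.trans ha.2⟩

/-- The Cauchy–Schwarz inequality on an interval. -/
theorem norm_integral_sq_le {X : Type*} [NormedAddCommGroup X] [NormedSpace ℝ X] {T : ℝ}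
    {u : ℝ → X} (hu : MemL2 T u) {a b t : ℝ} (ha : 0 ≤ a) (hb : b ≤ T) (ht : t ∈ Icc a b) :
    ‖∫ s in a..t, u s‖ ^ 2 ≤ (b - a) * ∫ s in a..b, ‖u s‖ ^ 2 := by
  have haI : a ∈ Icc 0 T := ⟨ha, (ht.1.trans ht.2).trans hb⟩
  have htI : t ∈ Icc 0 T := ⟨ha.trans ht.1, ht.2.trans hb⟩
  have hbI : b ∈ Icc 0 T := ⟨ha.trans (ht.1.trans ht.2), hb⟩
  have hi1 := (hu.intervalIntegrable haI htI).norm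
  have hi2 := hu.intervalIntegrable_norm_sq haI htI
  have h1 : ‖∫ s in a..t, u s‖ ^ 2 ≤ (t - a) * ∫ s in a..t, ‖u s‖ ^ 2 := by
    have h0 : ‖∫ s in a..t, u s‖ ≤ ∫ s in a..t, ‖u s‖ :=
      intervalIntegral.norm_integral_le_integral_norm ht.1
    set I := ∫ s in a..t, ‖u s‖ with hI
    have hsq : ‖∫ s in a..t, u s‖ ^ 2 ≤ I ^ 2 := pow_le_pow_left₀ (norm_nonneg _) h0 2
    rcases eq_or_lt_of_le ht.1 with rfl | hat
    · simp
    refine hsq.trans ?_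
    have hpos : 0 < t - a := sub_pos.mpr hat
    -- c is the mean of ‖u‖; nonnegativity of the variance is the Cauchy–Schwarz inequality.
    set c := I / (t - a) with hc
    have hcI : c * (t - a) = I := div_mul_cancel₀ _ hpos.ne'
    have hnn : 0 ≤ ∫ s in a..t, (‖u s‖ - c) ^ 2 :=
      intervalIntegral.integral_nonneg ht.1 fun s _ => sq_nonneg _
    have hexp : ∫ s in a..t, (‖u s‖ - c) ^ 2
        = (∫ s in a..t, ‖u s‖ ^ 2) - 2 * c * I + c ^ 2 * (t - a) := by
      have : ∀ s, (‖u s‖ - c) ^ 2 = ‖u s‖ ^ 2 - 2 * c * ‖u s‖ + c ^ 2 := fun s => by ring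
      simp only [this]
      rw [intervalIntegral.integral_add (hi2.sub (hi1.const_mul _)) intervalIntegrable_const,
        intervalIntegral.integral_sub hi2 (hi1.const_mul _), intervalIntegral.integral_const_mul,
        intervalIntegral.integral_const, smul_eq_mul]
      ring
    rw [hexp] at hnn
    nlinarith
  have h2 : ∫ s in a..t, ‖u s‖ ^ 2 ≤ ∫ s in a..b, ‖u s‖ ^ 2 := by
    rw [← intervalIntegral.integral_add_adjacent_intervals hi2
      (hu.intervalIntegrable_norm_sq htI hbI)]
    have : 0 ≤ ∫ s in t..b, ‖u s‖ ^ 2 :=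
      intervalIntegral.integral_nonneg ht.2 fun s _ => sq_nonneg _
    linarith
  have h3 : 0 ≤ ∫ s in a..t, ‖u s‖ ^ 2 :=
    intervalIntegral.integral_nonneg ht.1 fun s _ => sq_nonneg _
  calc _ ≤ (t - a) * ∫ s in a..t, ‖u s‖ ^ 2 := h1
    _ ≤ (b - a) * ∫ s in a..b, ‖u s‖ ^ 2 :=
      mul_le_mul (by linarith [ht.2]) h2 h3 (by linarith [ht.1, ht.2])

theorem integral_sub_mid (a b : ℝ) : ∫ t in a..b, (t - (a + b) / 2) = 0 := by
  rw [intervalIntegral.integral_sub (by simp) (by simp), integral_id,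
    intervalIntegral.integral_const, smul_eq_mul]
  ring

theorem hasDerivAt_primitive [CompleteSpace H] {T : ℝ} {w : ℝ → H} (hw : ContinuousOn w (Icc 0 T))
    {t : ℝ} (ht : t ∈ Ioo 0 T) : HasDerivAt (fun t => ∫ s in (0:ℝ)..t, w s) (w t) t := by
  have hnhds : Icc 0 T ∈ 𝓝 t := Icc_mem_nhds ht.1 ht.2
  refine intervalIntegral.integral_hasDerivAt_right ?_ ?_ (hw.continuousAt hnhds)
  · refine ContinuousOn.intervalIntegrable (hw.mono ?_)
    rw [uIcc_of_le ht.1.le]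
    exact Icc_subset_Icc_right ht.2.le
  · exact (hw.mono Ioo_subset_Icc_self).stronglyMeasurableAtFilter isOpen_Ioo t ht

/-- The parabolic equation tested on one subinterval with an affine function. -/
theorem integral_inner_affine [CompleteSpace V] [CompleteSpace H] {T : ℝ} {F w : ℝ → H} {Y : ℝ → V}
    {y₀ : H} (hw : ContinuousOn w (Icc 0 T))
    (hY : ContinuousOn Y (Icc 0 T))
    (hYw : ∀ t ∈ Icc 0 T, ι (Y t) = y₀ + ∫ s in (0:ℝ)..t, w s)
    (hE : ∀ t ∈ Icc 0 T, ∀ v, energy ι (Y t) v = ⟪F t - w t, ι v⟫_ℝ)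
    {a b : ℝ} (ha : 0 ≤ a) (hab : a < b) (hb : b ≤ T) (p q : V) :
    ∫ t in a..b, ⟪F t, ι (p + ((t - a) / (b - a)) • (q - p))⟫_ℝ
      = ⟪ι (Y b), ι q⟫_ℝ - ⟪ι (Y a), ι p⟫_ℝ
        - ⟪ι (q - p), ι ((b - a)⁻¹ • ∫ t in a..b, Y t)⟫_ℝ
        + (b - a) * energy ι ((b - a)⁻¹ • ∫ t in a..b, Y t) ((1 / 2 : ℝ) • (p + q))
        + ∫ t in a..b, (t - (a + b) / 2) / (b - a) * energy ι (Y t) (q - p) := by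
  have hk : 0 < b - a := sub_pos.mpr hab
  have hsub : Icc a b ⊆ Icc 0 T := Icc_subset_Icc ha hb
  have hu : uIcc a b = Icc a b := uIcc_of_le hab.le
  set P : ℝ → V := fun t => p + ((t - a) / (b - a)) • (q - p) with hP
  have hPc : Continuous P := by fun_prop
  have hPd : ∀ t, HasDerivAt P ((b - a)⁻¹ • (q - p)) t := by
    intro t
    have h1 : HasDerivAt (fun t => (t - a) / (b - a)) (b - a)⁻¹ t := by
      simpa [one_div] using ((hasDerivAt_id t).sub_const a).div_const (b - a)
    exact (h1.smul_const (q - p)).const_add p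
  have hYi : IntervalIntegrable Y volume a b :=
    ContinuousOn.intervalIntegrable (by rw [hu]; exact hY.mono hsub)
  have hιY : ContinuousOn (fun t => ι (Y t)) (Icc a b) :=
    ι.continuous.comp_continuousOn (hY.mono hsub)
  have hwi : IntervalIntegrable (fun t => ⟪w t, ι (P t)⟫_ℝ) volume a b := by
    refine ContinuousOn.intervalIntegrable ?_
    rw [hu]
    exact (hw.mono hsub).inner (ι.continuous.comp hPc).continuousOn
  have hιYi : IntervalIntegrable (fun t => ⟪ι (Y t), ι ((b - a)⁻¹ • (q - p))⟫_ℝ) volume a b := by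
    refine ContinuousOn.intervalIntegrable ?_
    rw [hu]
    exact hιY.inner continuousOn_const
  have h1 : ∫ t in a..b, ⟪w t, ι (P t)⟫_ℝ = ⟪ι (Y b), ι q⟫_ℝ - ⟪ι (Y a), ι p⟫_ℝ
      - ⟪ι (q - p), ι ((b - a)⁻¹ • ∫ t in a..b, Y t)⟫_ℝ := by
    have hftc := intervalIntegral.integral_eq_sub_of_hasDerivAt_of_le hab.le
      (f := fun t => ⟪ι (Y t), ι (P t)⟫_ℝ)
      (f' := fun t => ⟪ι (Y t), ι ((b - a)⁻¹ • (q - p))⟫_ℝ + ⟪w t, ι (P t)⟫_ℝ)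
      (hιY.inner (ι.continuous.comp hPc).continuousOn) (fun t ht => ?_) (hιYi.add hwi)
    · have hPa : P a = p := by simp [hP]
      have hPb : P b = q := by simp [hP, div_self hk.ne']
      rw [intervalIntegral.integral_add hιYi hwi, hPa, hPb] at hftc
      have e1 : ∫ t in a..b, ⟪ι (Y t), ι ((b - a)⁻¹ • (q - p))⟫_ℝ
          = ⟪ι (q - p), ι ((b - a)⁻¹ • ∫ t in a..b, Y t)⟫_ℝ := by
        have e2 := ((innerSL ℝ (ι (q - p))).comp ι).intervalIntegral_comp_comm hYi
        simp only [ContinuousLinearMap.comp_apply, innerSL_apply_apply] at e2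
        simp only [map_smul, inner_smul_right, ← e2, intervalIntegral.integral_const_mul,
          real_inner_comm]
      linarith
    · have hd1 : HasDerivAt (fun t => ι (Y t)) (w t) t := by
        have htI : t ∈ Ioo 0 T := ⟨ha.trans_lt ht.1, ht.2.trans_le hb⟩
        refine ((hasDerivAt_primitive hw htI).const_add y₀).congr_of_eventuallyEq ?_
        filter_upwards [Icc_mem_nhds htI.1 htI.2] with s hs using hYw s hs
      have hd2 := ι.hasFDerivAt.comp_hasDerivAt t (hPd t)
      exact hd1.inner ℝ hd2
  -- Splitting P about the midpoint: the constant part sees only the mean of Y, and the odd part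
  -- produces the consistency error.
  have hd : ∀ t, P t = (1 / 2 : ℝ) • (p + q) + ((t - (a + b) / 2) / (b - a)) • (q - p) := by
    intro t
    have : (t - a) / (b - a) = 1 / 2 + (t - (a + b) / 2) / (b - a) := by
      field_simp
      ring
    simp only [hP, this]
    module
  have h2 : ∫ t in a..b, energy ι (Y t) (P t)
      = (b - a) * energy ι ((b - a)⁻¹ • ∫ t in a..b, Y t) ((1 / 2 : ℝ) • (p + q))
        + ∫ t in a..b, (t - (a + b) / 2) / (b - a) * energy ι (Y t) (q - p) := by
    have e1 := ((energy ι).flip ((1 / 2 : ℝ) • (p + q))).intervalIntegral_comp_comm hYi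
    simp only [ContinuousLinearMap.flip_apply] at e1
    have i1 : IntervalIntegrable (fun t => energy ι (Y t) ((1 / 2 : ℝ) • (p + q))) volume a b := by
      refine ContinuousOn.intervalIntegrable ?_
      rw [hu]
      exact ((energy ι).flip ((1 / 2 : ℝ) • (p + q))).continuous.comp_continuousOn (hY.mono hsub)
    have i2 : IntervalIntegrable
        (fun t => (t - (a + b) / 2) / (b - a) * energy ι (Y t) (q - p)) volume a b := by
      refine ContinuousOn.intervalIntegrable ?_
      rw [hu]
      refine ContinuousOn.mul (by fun_prop) ?_
      exact ((energy ι).flip (q - p)).continuous.comp_continuousOn (hY.mono hsub)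
    rw [map_smul (energy ι) (b - a)⁻¹, smul_apply, ← e1, smul_eq_mul, mul_inv_cancel_left₀ hk.ne',
      ← intervalIntegral.integral_add i1 i2]
    refine intervalIntegral.integral_congr fun t _ => ?_
    simp only [hd t, map_add, map_smul, smul_eq_mul]
  have hEi : IntervalIntegrable (fun t => energy ι (Y t) (P t)) volume a b := by
    refine ContinuousOn.intervalIntegrable ?_
    rw [hu]
    exact ((energy ι).continuous.comp_continuousOn (hY.mono hsub)).clm_apply hPc.continuousOn
  rw [← h1, add_assoc, ← h2, ← intervalIntegral.integral_add hwi hEi]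
  refine intervalIntegral.integral_congr fun t ht => ?_
  rw [hu] at ht
  simp only [hE t (hsub ht), inner_sub_left]
  simp only [hP]
  ring

/-- The consistency error on one subinterval. -/
theorem abs_integral_mid_mul_energy_le [CompleteSpace H] {T : ℝ} {Z z' : ℝ → H} {Y : ℝ → V}
    (hZc : ContinuousOn Z (Icc 0 T)) (hz' : MemL2 T z')
    (hZ : ∀ t ∈ Icc 0 T, Z t = Z 0 + ∫ s in (0:ℝ)..t, z' s)
    (hE : ∀ t ∈ Icc 0 T, ∀ v, energy ι (Y t) v = ⟪Z t, ι v⟫_ℝ)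
    {a b : ℝ} (ha : 0 ≤ a) (hab : a < b) (hb : b ≤ T) (d : V) :
    |∫ t in a..b, (t - (a + b) / 2) / (b - a) * energy ι (Y t) d|
      ≤ (‖ι d‖ ^ 2 / (b - a) + (b - a) ^ 4 / 4 * ∫ s in a..b, ‖z' s‖ ^ 2) / 2 := by
  have hk : 0 < b - a := sub_pos.mpr hab
  have hsub : Icc a b ⊆ Icc 0 T := Icc_subset_Icc ha hb
  have hu : uIcc a b = Icc a b := uIcc_of_le hab.le
  have h0 : (0 : ℝ) ∈ Icc 0 T := ⟨le_rfl, ha.trans (hab.le.trans hb)⟩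
  have haI : a ∈ Icc 0 T := hsub (left_mem_Icc.mpr hab.le)
  set z := ∫ s in a..b, ‖z' s‖ ^ 2 with hz
  have hz0 : 0 ≤ z := intervalIntegral.integral_nonneg hab.le fun s _ => sq_nonneg _
  have hdiff : ∀ t ∈ Icc a b, ‖Z t - Z a‖ ≤ √((b - a) * z) := by
    intro t ht
    have htI := hsub ht
    apply Real.le_sqrt_of_sq_le
    rw [hZ t htI, hZ a haI, add_sub_add_left_eq_sub, intervalIntegral.integral_interval_sub_left
      (hz'.intervalIntegrable h0 htI) (hz'.intervalIntegrable h0 haI)]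
    exact norm_integral_sq_le hz' ha hb ht
  -- The weight has mean zero, so Z(a) can be subtracted and only the increment of Z, controlled by
  -- z', remains.
  have e1 : ∫ t in a..b, (t - (a + b) / 2) / (b - a) * energy ι (Y t) d
      = ∫ t in a..b, (t - (a + b) / 2) / (b - a) * ⟪Z t - Z a, ι d⟫_ℝ := by
    have i1 : IntervalIntegrable
        (fun t => (t - (a + b) / 2) / (b - a) * ⟪Z t, ι d⟫_ℝ) volume a b := by
      refine ContinuousOn.intervalIntegrable ?_
      rw [hu]
      exact ContinuousOn.mul (by fun_prop) ((hZc.mono hsub).inner continuousOn_const)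
    have i2 : IntervalIntegrable
        (fun t => (t - (a + b) / 2) * (⟪Z a, ι d⟫_ℝ / (b - a))) volume a b :=
      Continuous.intervalIntegrable (by fun_prop) _ _
    have e2 : ∫ t in a..b, (t - (a + b) / 2) * (⟪Z a, ι d⟫_ℝ / (b - a)) = 0 := by
      rw [intervalIntegral.integral_mul_const, integral_sub_mid, zero_mul]
    rw [← sub_zero (∫ t in a..b, (t - (a + b) / 2) / (b - a) * energy ι (Y t) d), ← e2,
      intervalIntegral.integral_congr (g := fun t => (t - (a + b) / 2) / (b - a) * ⟪Z t, ι d⟫_ℝ)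
      (fun t ht => by rw [hu] at ht; simp only [hE t (hsub ht)]),
      ← intervalIntegral.integral_sub i1 i2]
    refine intervalIntegral.integral_congr fun t _ => ?_
    simp only [inner_sub_left]
    ring
  have e3 : ‖∫ t in a..b, (t - (a + b) / 2) / (b - a) * ⟪Z t - Z a, ι d⟫_ℝ‖
      ≤ 1 / 2 * (√((b - a) * z) * ‖ι d‖) * |b - a| := by
    refine intervalIntegral.norm_integral_le_of_norm_le_const fun t ht => ?_
    rw [uIoc_of_le hab.le] at ht
    have htI : t ∈ Icc a b := Ioc_subset_Icc_self ht
    rw [norm_mul]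
    refine mul_le_mul ?_ ((abs_real_inner_le_norm _ _).trans
      (mul_le_mul_of_nonneg_right (hdiff t htI) (norm_nonneg _))) (norm_nonneg _) (by norm_num)
    rw [Real.norm_eq_abs, abs_div, abs_of_pos hk, div_le_iff₀ hk, abs_le]
    constructor <;> linarith [ht.1, ht.2]
  rw [e1, ← Real.norm_eq_abs]
  refine e3.trans ?_
  rw [abs_of_pos hk, Real.sqrt_mul hk.le]
  set k := b - a
  have hA : (√k) ^ 2 = k := Real.sq_sqrt hk.le
  have hz1 : (√z) ^ 2 = z := Real.sq_sqrt hz0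
  have hsk : 0 < √k := Real.sqrt_pos.mpr hk
  have e4 : ‖ι d‖ ^ 2 / k = (‖ι d‖ / √k) ^ 2 := by rw [div_pow, hA]
  have e5 : k ^ 4 / 4 * z = (k ^ 2 / 2 * √z) ^ 2 := by rw [mul_pow, hz1]; ring
  -- The powers of k are distributed so that Young's inequality yields ‖ι d‖² / k, exactly what the
  -- discrete dual problem controls.
  have e6 : 1 / 2 * (√k * √z * ‖ι d‖) * k = (‖ι d‖ / √k) * (k ^ 2 / 2 * √z) := by
    rw [show ‖ι d‖ / √k * (k ^ 2 / 2 * √z) = (‖ι d‖ * k * √z / 2) * (k / √k) by ring,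
      Real.div_sqrt]
    ring
  rw [e4, e5, e6]
  nlinarith [sq_nonneg (‖ι d‖ / √k - k ^ 2 / 2 * √z)]

end Interval

/-! ### The dual problem and the error of the discrete solution -/

namespace TimeGrid

variable {T : ℝ} (G : TimeGrid T)

theorem t_le_t {i j : ℕ} (hij : i ≤ j) (hj : j ≤ G.M) : G.t i ≤ G.t j := by
  induction j, hij using Nat.le_induction with
  | base => exact le_rfl
  | succ l _ ih => exact (ih (by omega)).trans (G.lt l (by omega)).le

theorem t_nonneg {m : ℕ} (hm : m ≤ G.M) : 0 ≤ G.t m := by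
  simpa [G.zero] using G.t_le_t (Nat.zero_le m) hm

theorem t_le {m : ℕ} (hm : m ≤ G.M) : G.t m ≤ T := (G.t_le_t hm le_rfl).trans_eq G.last

theorem t_mem {m : ℕ} (hm : m ≤ G.M) : G.t m ∈ Icc 0 T := ⟨G.t_nonneg hm, G.t_le hm⟩

theorem step_pos {m : ℕ} (hm : m < G.M) : 0 < G.step m := sub_pos.mpr (G.lt m hm)

theorem step_le_width {m : ℕ} (hm : m < G.M) : G.step m ≤ G.width :=
  le_ciSup (f := fun m : Fin G.M => G.step m) (Set.finite_range _).bddAbove ⟨m, hm⟩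

theorem sum_integral {X : Type*} [NormedAddCommGroup X] [NormedSpace ℝ X] {u : ℝ → X}
    (hu : ∀ m < G.M, IntervalIntegrable u volume (G.t m) (G.t (m + 1))) :
    ∑ m ∈ Finset.range G.M, ∫ s in G.t m..G.t (m + 1), u s = ∫ s in (0:ℝ)..T, u s := by
  rw [intervalIntegral.sum_integral_adjacent_intervals hu, G.zero, G.last]

theorem sum_integral_norm_sq {X : Type*} [NormedAddCommGroup X] {u : ℝ → X} (hu : MemL2 T u) :
    ∑ m ∈ Finset.range G.M, ∫ s in G.t m..G.t (m + 1), ‖u s‖ ^ 2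
      = ∫ s in (0:ℝ)..T, ‖u s‖ ^ 2 :=
  G.sum_integral fun _ hm =>
    hu.intervalIntegrable_norm_sq (G.t_mem hm.le) (G.t_mem (Nat.succ_le_of_lt hm))

end TimeGrid

section Discrete

open scoped InnerProductSpace

variable {V H : Type*} [NormedAddCommGroup V] [InnerProductSpace ℝ V]
  [NormedAddCommGroup H] [InnerProductSpace ℝ H] {ι : V →L[ℝ] H}

/-- Stability of the discrete dual problem. -/
theorem sum_discrete_dual_le (hι : ∀ v, ‖ι v‖ ≤ ‖v‖) {T : ℝ} (G : TimeGrid T) {e p : ℕ → V}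
    (hpM : p G.M = 0) (hp : ∀ m < G.M, ∀ v,
      ⟪ι (p m - p (m + 1)), ι v⟫_ℝ + G.step m * energy ι v ((1 / 2 : ℝ) • (p m + p (m + 1)))
        = G.step m * ⟪ι (e m), ι v⟫_ℝ) :
    ∑ m ∈ Finset.range G.M, ‖ι (p (m + 1) - p m)‖ ^ 2 / G.step m
      ≤ ∑ m ∈ Finset.range G.M, G.step m * ‖ι (e m)‖ ^ 2 := by
  have hle : ∀ m ∈ Finset.range G.M, ‖ι (p (m + 1) - p m)‖ ^ 2 / G.step m
      ≤ G.step m * ‖ι (e m)‖ ^ 2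
        + (energy ι (p (m + 1)) (p (m + 1)) - energy ι (p m) (p m)) := by
    intro m hm
    have hm' := Finset.mem_range.mp hm
    have hk := G.step_pos hm'
    -- Testing with the increment makes the energy term a difference of squares, which telescopes
    -- over m.
    have h := hp m hm' (p m - p (m + 1))
    have hE : energy ι (p m - p (m + 1)) ((1 / 2 : ℝ) • (p m + p (m + 1)))
        = (energy ι (p m) (p m) - energy ι (p (m + 1)) (p (m + 1))) / 2 := by
      simp only [map_sub, map_add, map_smul, sub_apply, smul_eq_mul,
        energy_comm ι (p (m + 1)) (p m)]
      ring
    rw [hE, real_inner_self_eq_norm_sq] at h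
    have hy : ⟪ι (e m), ι (p m - p (m + 1))⟫_ℝ ≤ ‖ι (e m)‖ * ‖ι (p m - p (m + 1))‖ :=
      real_inner_le_norm _ _
    have hn : ‖ι (p (m + 1) - p m)‖ = ‖ι (p m - p (m + 1))‖ := by
      rw [← norm_neg, ← map_neg, neg_sub]
    rw [hn, div_le_iff₀ hk]
    nlinarith [sq_nonneg (G.step m * ‖ι (e m)‖ - ‖ι (p m - p (m + 1))‖),
      mul_le_mul_of_nonneg_left hy hk.le]
  refine (Finset.sum_le_sum hle).trans ?_
  rw [Finset.sum_add_distrib, Finset.sum_range_sub (fun m => energy ι (p m) (p m)), hpM, map_zero]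
  have := energy_self_nonneg hι (p 0)
  linarith

variable [CompleteSpace V]

/-- Solvability of one Crank–Nicolson step. -/
theorem exists_crankNicolson_step (hι : ∀ v, ‖ι v‖ ≤ ‖v‖) {k : ℝ} (hk : 0 < k) (q e : V) :
    ∃ p : V, ∀ v, ⟪ι (p - q), ι v⟫_ℝ + k * energy ι v ((1 / 2 : ℝ) • (p + q))
      = k * ⟪ι e, ι v⟫_ℝ := by
  let J : V →L[ℝ] V →L[ℝ] ℝ := (innerSL ℝ).bilinearComp ι ι
  let B : V →L[ℝ] V →L[ℝ] ℝ := J + (k / 2) • energy ι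
  have hJ : ∀ u v, J u v = ⟪ι u, ι v⟫_ℝ := fun u v => rfl
  have hB : ∀ u v, B u v = ⟪ι u, ι v⟫_ℝ + k / 2 * energy ι u v := fun u v => rfl
  -- Lax–Milgram applies: ‖u‖² is the sum of ‖ι u‖² and the energy, which enter B with the weights 1
  -- and k / 2.
  have hco : IsCoercive B := by
    refine ⟨min 1 (k / 2), lt_min one_pos (by positivity), fun u => ?_⟩
    have h0 := energy_self_nonneg hι u
    have h1 : ‖u‖ * ‖u‖ = ⟪ι u, ι u⟫_ℝ + energy ι u u := by
      rw [energy_apply, ← real_inner_self_eq_norm_mul_norm]; ring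
    have h2 : 0 ≤ ⟪ι u, ι u⟫_ℝ := real_inner_self_nonneg
    rw [hB, mul_assoc, h1]
    nlinarith [min_le_left 1 (k / 2), min_le_right 1 (k / 2)]
  let L : StrongDual ℝ V := J q - (k / 2) • energy ι q + k • J e
  obtain ⟨p, hp⟩ : ∃ p, ∀ v, B p v = L v := by
    refine ⟨hco.continuousLinearEquivOfBilin.symm ((InnerProductSpace.toDual ℝ V).symm L), ?_⟩
    intro v
    rw [← hco.continuousLinearEquivOfBilin_apply, ContinuousLinearEquiv.apply_symm_apply,
      InnerProductSpace.toDual_symm_apply]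
  refine ⟨p, fun v => ?_⟩
  have h := hp v
  have hL : L v = ⟪ι q, ι v⟫_ℝ - k / 2 * energy ι q v + k * ⟪ι e, ι v⟫_ℝ := rfl
  rw [hB, hL] at h
  rw [energy_comm ι v]
  simp only [map_sub, map_add, map_smul, add_apply, smul_apply, smul_eq_mul, inner_sub_left]
  linarith

/-- The discrete dual problem. -/
theorem exists_discrete_dual (hι : ∀ v, ‖ι v‖ ≤ ‖v‖) {T : ℝ} (G : TimeGrid T) (e : ℕ → V) :
    ∃ p : ℕ → V, p G.M = 0 ∧ ∀ m < G.M, ∀ v,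
      ⟪ι (p m - p (m + 1)), ι v⟫_ℝ + G.step m * energy ι v ((1 / 2 : ℝ) • (p m + p (m + 1)))
        = G.step m * ⟪ι (e m), ι v⟫_ℝ := by
  have hstep : ∀ (m : ℕ) (q : V), ∃ p : V, m < G.M → ∀ v,
      ⟪ι (p - q), ι v⟫_ℝ + G.step m * energy ι v ((1 / 2 : ℝ) • (p + q))
        = G.step m * ⟪ι (e m), ι v⟫_ℝ := by
    intro m q
    by_cases hm : m < G.M
    · obtain ⟨p, hp⟩ := exists_crankNicolson_step hι (G.step_pos hm) q (e m)
      exact ⟨p, fun _ => hp⟩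
    · exact ⟨0, fun h => absurd h hm⟩
  choose S hS using hstep
  -- The recursion runs backwards from T: r j is the nodal value at index M - j.
  let r : ℕ → V := fun j => Nat.rec 0 (fun i q => S (G.M - 1 - i) q) j
  refine ⟨fun m => r (G.M - m), by simp [r], fun m hm v => ?_⟩
  have h1 : r (G.M - m) = S m (r (G.M - (m + 1))) := by
    obtain ⟨i, hi⟩ : ∃ i, G.M - m = i + 1 := ⟨G.M - m - 1, by omega⟩
    have hi' : G.M - (m + 1) = i := by omega
    have hm' : G.M - 1 - i = m := by omega
    rw [hi, hi', ← hm']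
  simp only [h1]
  exact hS m _ hm v

/-- The mean value of `Y` over the `m`-th subinterval. -/
def mean {V : Type*} [NormedAddCommGroup V] [InnerProductSpace ℝ V] {T : ℝ}
    (G : TimeGrid T) (Y : ℝ → V) (m : ℕ) : V :=
  (G.t (m + 1) - G.t m)⁻¹ • ∫ t in G.t m..G.t (m + 1), Y t

/-- The discrete solution is of second order close to the interval means of the solution. -/
theorem sum_error_mean_le [CompleteSpace H] (hι : ∀ v, ‖ι v‖ ≤ ‖v‖) {T : ℝ} (G : TimeGrid T)
    {F w z' : ℝ → H} {Y : ℝ → V} {y₀ : H}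
    (hF : ContinuousOn F (Icc 0 T)) (hw : ContinuousOn w (Icc 0 T))
    (hY : ContinuousOn Y (Icc 0 T))
    (hYw : ∀ t ∈ Icc 0 T, ι (Y t) = y₀ + ∫ s in (0:ℝ)..t, w s)
    (hE : ∀ t ∈ Icc 0 T, ∀ v, energy ι (Y t) v = ⟪F t - w t, ι v⟫_ℝ)
    (hz' : MemL2 T z')
    (hZ : ∀ t ∈ Icc 0 T, F t - w t = F 0 - w 0 + ∫ s in (0:ℝ)..t, z' s)
    {a : ℕ → V}
    (ha : ∀ p : ℕ → V, p G.M = 0 →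
      ∑ m ∈ Finset.range G.M, (-⟪ι (p (m + 1) - p m), ι (a m)⟫_ℝ
          + G.step m * energy ι (a m) ((1 / 2 : ℝ) • (p m + p (m + 1))))
        = (∑ m ∈ Finset.range G.M, ∫ t in G.t m..G.t (m + 1),
            ⟪F t, ι (p m + ((t - G.t m) / (G.t (m + 1) - G.t m)) • (p (m + 1) - p m))⟫_ℝ)
          + ⟪y₀, ι (p 0)⟫_ℝ) :
    ∑ m ∈ Finset.range G.M, G.step m * ‖ι (a m - mean G Y m)‖ ^ 2
      ≤ G.width ^ 4 / 4 * ∫ s in (0:ℝ)..T, ‖z' s‖ ^ 2 := by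
  -- Duality argument: the error itself is the right-hand side of the dual problem.
  obtain ⟨p, hpM, hp⟩ := exists_discrete_dual hι G (fun m => a m - mean G Y m)
  have hstab := sum_discrete_dual_le hι G hpM hp
  set Q := ∑ m ∈ Finset.range G.M, G.step m * ‖ι (a m - mean G Y m)‖ ^ 2 with hQ
  set ρ : ℕ → ℝ := fun m => ∫ t in G.t m..G.t (m + 1),
    (t - (G.t m + G.t (m + 1)) / 2) / (G.t (m + 1) - G.t m) * energy ι (Y t) (p (m + 1) - p m)
    with hρ
  have hT : 0 ≤ T := (G.t_nonneg le_rfl).trans (G.t_le le_rfl)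
  have hcont : ∀ m < G.M, ∫ t in G.t m..G.t (m + 1),
      ⟪F t, ι (p m + ((t - G.t m) / (G.t (m + 1) - G.t m)) • (p (m + 1) - p m))⟫_ℝ
      = (⟪ι (Y (G.t (m + 1))), ι (p (m + 1))⟫_ℝ - ⟪ι (Y (G.t m)), ι (p m)⟫_ℝ)
        + (-⟪ι (p (m + 1) - p m), ι (mean G Y m)⟫_ℝ
          + G.step m * energy ι (mean G Y m) ((1 / 2 : ℝ) • (p m + p (m + 1)))) + ρ m := by
    intro m hm
    rw [integral_inner_affine hw hY hYw hE (G.t_nonneg hm.le) (G.lt m hm)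
      (G.t_le (Nat.succ_le_of_lt hm)) (p m) (p (m + 1))]
    simp only [hρ, mean, TimeGrid.step]
    ring
  have h1 := ha p hpM
  have hsum := Finset.sum_congr rfl fun m hm => hcont m (Finset.mem_range.mp hm)
  -- The nodal products telescope. The end value drops out since p vanishes at T; the initial one
  -- cancels against the datum y₀.
  rw [Finset.sum_add_distrib, Finset.sum_add_distrib,
    Finset.sum_range_sub (fun m => ⟪ι (Y (G.t m)), ι (p m)⟫_ℝ), hpM,
    G.zero, hYw 0 (left_mem_Icc.mpr hT), intervalIntegral.integral_same, add_zero, map_zero,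
    inner_zero_right] at hsum
  rw [hsum] at h1
  have hQρ : Q = ∑ m ∈ Finset.range G.M, ρ m := by
    have h2 : Q = ∑ m ∈ Finset.range G.M, ((-⟪ι (p (m + 1) - p m), ι (a m)⟫_ℝ
          + G.step m * energy ι (a m) ((1 / 2 : ℝ) • (p m + p (m + 1))))
        - (-⟪ι (p (m + 1) - p m), ι (mean G Y m)⟫_ℝ
          + G.step m * energy ι (mean G Y m) ((1 / 2 : ℝ) • (p m + p (m + 1))))) := by
      refine Finset.sum_congr rfl fun m hm => ?_
      rw [← real_inner_self_eq_norm_sq, ← hp m (Finset.mem_range.mp hm),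
        show p m - p (m + 1) = -(p (m + 1) - p m) by abel]
      simp only [map_sub, map_neg, sub_apply, inner_neg_left, inner_sub_left, inner_sub_right]
      ring
    rw [h2, Finset.sum_sub_distrib]
    linarith
  have hρle : ∑ m ∈ Finset.range G.M, ρ m ≤ ∑ m ∈ Finset.range G.M,
      (‖ι (p (m + 1) - p m)‖ ^ 2 / G.step m
        + G.width ^ 4 / 4 * ∫ s in G.t m..G.t (m + 1), ‖z' s‖ ^ 2) / 2 := by
    refine Finset.sum_le_sum fun m hm => ?_
    have hm' := Finset.mem_range.mp hm
    have h3 := abs_integral_mid_mul_energy_le (Z := fun t => F t - w t) (hF.sub hw) hz' hZ hE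
      (G.t_nonneg hm'.le) (G.lt m hm') (G.t_le (Nat.succ_le_of_lt hm')) (p (m + 1) - p m)
    have h4 : 0 ≤ ∫ s in G.t m..G.t (m + 1), ‖z' s‖ ^ 2 :=
      intervalIntegral.integral_nonneg (G.lt m hm').le fun s _ => sq_nonneg _
    have h5 : (G.t (m + 1) - G.t m) ^ 4 ≤ G.width ^ 4 :=
      pow_le_pow_left₀ (G.step_pos hm').le (G.step_le_width hm') 4
    refine (le_abs_self _).trans (h3.trans ?_)
    simp only [TimeGrid.step]
    gcongr
  -- By `hstab` this bounds Q by half of Q plus half of the claimed bound, so Q can be absorbed.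
  rw [← Finset.sum_div, Finset.sum_add_distrib, ← Finset.mul_sum, G.sum_integral_norm_sq hz']
    at hρle
  linarith

end Discrete

/-! ### The interpolation error on the dual grid -/

section Interpolation

variable {V H : Type*} [NormedAddCommGroup V] [InnerProductSpace ℝ V]
  [NormedAddCommGroup H] [InnerProductSpace ℝ H] {ι : V →L[ℝ] H}

/-- First-order Taylor remainder at a, where w = h' and x = h''. It is the integral of w - w(a), and
Cauchy–Schwarz bounds that increment by the L² norm of x. -/
theorem norm_sub_sub_smul_le [CompleteSpace H] {T : ℝ} {h w x : ℝ → H} (hx : MemL2 T x)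
    (hw : ∀ t ∈ Icc 0 T, w t = w 0 + ∫ s in (0:ℝ)..t, x s)
    (hh : ∀ t ∈ Icc 0 T, h t = h 0 + ∫ s in (0:ℝ)..t, w s)
    {a b s : ℝ} (ha : 0 ≤ a) (hb : b ≤ T) (hs : s ∈ Icc a b) :
    ‖h s - h a - (s - a) • w a‖ ≤ √((b - a) ^ 3 * ∫ s in a..b, ‖x s‖ ^ 2) := by
  have hab : a ≤ b := hs.1.trans hs.2
  have hsub : Icc a b ⊆ Icc 0 T := Icc_subset_Icc ha hb
  have h0 : (0 : ℝ) ∈ Icc 0 T := ⟨le_rfl, ha.trans (hab.trans hb)⟩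
  have haI : a ∈ Icc 0 T := hsub (left_mem_Icc.mpr hab)
  have hsI : s ∈ Icc 0 T := hsub hs
  have hwc : ContinuousOn w (Icc 0 T) :=
    (continuousOn_const.add (continuousOn_primitive hx)).congr hw
  have hwi : ∀ {c d}, c ∈ Icc 0 T → d ∈ Icc 0 T → IntervalIntegrable w volume c d :=
    fun hc hd => (memL2_of_continuousOn hwc).intervalIntegrable hc hd
  have e1 : h s - h a - (s - a) • w a = ∫ t in a..s, (w t - w a) := by
    rw [hh s hsI, hh a haI, add_sub_add_left_eq_sub,
      intervalIntegral.integral_interval_sub_left (hwi h0 hsI) (hwi h0 haI),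
      intervalIntegral.integral_sub (hwi haI hsI) intervalIntegrable_const,
      intervalIntegral.integral_const]
  set z := ∫ s in a..b, ‖x s‖ ^ 2
  have hdiff : ∀ t ∈ Icc a b, ‖w t - w a‖ ≤ √((b - a) * z) := by
    intro t ht
    have htI := hsub ht
    apply Real.le_sqrt_of_sq_le
    rw [hw t htI, hw a haI, add_sub_add_left_eq_sub, intervalIntegral.integral_interval_sub_left
      (hx.intervalIntegrable h0 htI) (hx.intervalIntegrable h0 haI)]
    exact norm_integral_sq_le hx ha hb ht
  rw [e1]
  have e2 : ‖∫ t in a..s, (w t - w a)‖ ≤ √((b - a) * z) * |s - a| := by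
    refine intervalIntegral.norm_integral_le_of_norm_le_const fun t ht => hdiff t ?_
    rw [uIoc_of_le hs.1] at ht
    exact ⟨ht.1.le, ht.2.trans hs.2⟩
  have e3 : |s - a| ≤ b - a := by
    rw [abs_of_nonneg (by linarith [hs.1])]
    linarith [hs.2]
  calc _ ≤ √((b - a) * z) * (b - a) := e2.trans (mul_le_mul_of_nonneg_left e3 (Real.sqrt_nonneg _))
    _ = √((b - a) * z) * √((b - a) ^ 2) := by rw [Real.sqrt_sq (by linarith)]
    _ = √((b - a) ^ 3 * z) := by
      rw [← Real.sqrt_mul' _ (sq_nonneg _)]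
      congr 1
      ring

/-- The error of the mean value on a subinterval `[c, d]` of `[a, b]`. -/
theorem norm_mean_sub_sub_smul_le [CompleteSpace H] {T : ℝ} {h w x : ℝ → H} (hx : MemL2 T x)
    (hw : ∀ t ∈ Icc 0 T, w t = w 0 + ∫ s in (0:ℝ)..t, x s)
    (hh : ∀ t ∈ Icc 0 T, h t = h 0 + ∫ s in (0:ℝ)..t, w s) (hhc : ContinuousOn h (Icc 0 T))
    {a b c d : ℝ} (ha : 0 ≤ a) (hb : b ≤ T) (hc : a ≤ c) (hcd : c < d) (hd : d ≤ b) :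
    ‖(d - c)⁻¹ • (∫ t in c..d, h t) - h a - ((c + d) / 2 - a) • w a‖
      ≤ √((b - a) ^ 3 * ∫ s in a..b, ‖x s‖ ^ 2) := by
  have hk : 0 < d - c := sub_pos.mpr hcd
  have hhi : IntervalIntegrable h volume c d := by
    refine ContinuousOn.intervalIntegrable (hhc.mono ?_)
    rw [uIcc_of_le hcd.le]
    exact Icc_subset_Icc (ha.trans hc) (hd.trans hb)
  have hai : IntervalIntegrable (fun t => (t - a) • w a) volume c d :=
    Continuous.intervalIntegrable (by fun_prop) _ _
  -- The mean of an affine function is its midpoint value, so the mean inherits the pointwise Taylor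
  -- remainder.
  have e1 : (d - c)⁻¹ • (∫ t in c..d, h t) - h a - ((c + d) / 2 - a) • w a
      = (d - c)⁻¹ • ∫ t in c..d, (h t - h a - (t - a) • w a) := by
    have e0 : ∫ t in c..d, (t - a) = (d - c) * ((c + d) / 2 - a) := by
      rw [intervalIntegral.integral_sub (by simp) (by simp), integral_id,
        intervalIntegral.integral_const, smul_eq_mul]
      ring
    rw [intervalIntegral.integral_sub (hhi.sub intervalIntegrable_const) hai,
      intervalIntegral.integral_sub hhi intervalIntegrable_const, intervalIntegral.integral_const,
      intervalIntegral.integral_smul_const, e0, smul_sub, smul_sub, smul_smul, smul_smul,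
      inv_mul_cancel₀ hk.ne', one_smul, inv_mul_cancel_left₀ hk.ne']
  have e2 : ‖∫ t in c..d, (h t - h a - (t - a) • w a)‖
      ≤ √((b - a) ^ 3 * ∫ s in a..b, ‖x s‖ ^ 2) * |d - c| := by
    refine intervalIntegral.norm_integral_le_of_norm_le_const fun t ht => ?_
    rw [uIoc_of_le hcd.le] at ht
    exact norm_sub_sub_smul_le hx hw hh ha hb ⟨hc.trans ht.1.le, ht.2.trans hd⟩
  rw [e1, norm_smul, norm_inv, Real.norm_eq_abs, inv_mul_le_iff₀ (abs_pos.mpr hk.ne'), mul_comm]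
  exact e2

/-- The affine Taylor polynomial g + (· - a) η is reproduced by interpolation and cancels. What
remains is A - α and B - β with weights at most 2 and three remainders totalling at most 5 R;
squaring a sum of three terms gives 3·4, 3·4 and 3·25. -/
theorem norm_interp_sq_le {A B α β g η r R₁ R₂ : H} {a s m₁ m₂ R : ℝ} (hm : m₁ < m₂)
    (hs₁ : -1 ≤ (s - m₁) / (m₂ - m₁)) (hs₂ : (s - m₁) / (m₂ - m₁) ≤ 2)
    (hα : α - g - (m₁ - a) • η = R₁) (hβ : β - g - (m₂ - a) • η = R₂)
    {y : H} (hy : y - g - (s - a) • η = r) (h₁ : ‖R₁‖ ≤ R) (h₂ : ‖R₂‖ ≤ R) (h₃ : ‖r‖ ≤ R) :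
    ‖A + ((s - m₁) / (m₂ - m₁)) • (B - A) - y‖ ^ 2
      ≤ 12 * ‖A - α‖ ^ 2 + 12 * ‖B - β‖ ^ 2 + 75 * R ^ 2 := by
  set l := (s - m₁) / (m₂ - m₁) with hl
  have hls : l * (m₂ - m₁) = s - m₁ := div_mul_cancel₀ _ (sub_pos.mpr hm).ne'
  have e1 : A + l • (B - A) - y = (1 - l) • (A - α) + l • (B - β)
      + ((1 - l) • R₁ + l • R₂ - r) := by
    rw [← hα, ← hβ, ← hy]
    have : s - a = (1 - l) * (m₁ - a) + l * (m₂ - a) := by linarith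
    rw [this]
    module
  have hl1 : |1 - l| ≤ 2 := by rw [abs_le]; constructor <;> linarith
  have hl2 : |l| ≤ 2 := by rw [abs_le]; constructor <;> linarith
  have hR : 0 ≤ R := (norm_nonneg _).trans h₁
  have e2 : ‖A + l • (B - A) - y‖ ≤ 2 * ‖A - α‖ + 2 * ‖B - β‖ + 5 * R := by
    rw [e1]
    have n1 : ‖(1 - l) • (A - α)‖ ≤ 2 * ‖A - α‖ := by
      rw [norm_smul]; exact mul_le_mul_of_nonneg_right hl1 (norm_nonneg _)
    have n2 : ‖l • (B - β)‖ ≤ 2 * ‖B - β‖ := by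
      rw [norm_smul]; exact mul_le_mul_of_nonneg_right hl2 (norm_nonneg _)
    have n3 : ‖(1 - l) • R₁‖ ≤ 2 * R := by
      rw [norm_smul]; exact mul_le_mul hl1 h₁ (norm_nonneg _) (by norm_num)
    have n4 : ‖l • R₂‖ ≤ 2 * R := by
      rw [norm_smul]; exact mul_le_mul hl2 h₂ (norm_nonneg _) (by norm_num)
    have n5 := norm_add₃_le (a := (1 - l) • (A - α)) (b := l • (B - β))
      (c := (1 - l) • R₁ + l • R₂ - r)
    have n6 := norm_sub_le ((1 - l) • R₁ + l • R₂) r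
    have n7 := norm_add_le ((1 - l) • R₁) (l • R₂)
    linarith
  refine (pow_le_pow_left₀ (norm_nonneg _) e2 2).trans ?_
  nlinarith [sq_nonneg (2 * ‖A - α‖ - 2 * ‖B - β‖), sq_nonneg (2 * ‖A - α‖ - 5 * R),
    sq_nonneg (2 * ‖B - β‖ - 5 * R)]

/-- A primal subinterval meets only the dual pieces starting at its own or the preceding midpoint.
The two end half-intervals use the extrapolated first and last pieces. -/
theorem TimeGrid.exists_dual_interval {T : ℝ} (G : TimeGrid T) (hM : 2 ≤ G.M) {m : ℕ} (hm : m < G.M)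
    {s : ℝ} (hs : s ∈ Ico (G.t m) (G.t (m + 1))) :
    ∃ j, j + 2 ≤ G.M ∧ (j = m ∨ j + 1 = m) ∧ (j = 0 ∨ G.mid j ≤ s) ∧
      (j + 2 = G.M ∨ s < G.mid (j + 1)) := by
  have hmid₁ : ∀ j < G.M, G.t j < G.mid j := fun j hj => by
    have := G.lt j hj; unfold TimeGrid.mid; linarith
  have hmid₂ : ∀ j < G.M, G.mid j < G.t (j + 1) := fun j hj => by
    have := G.lt j hj; unfold TimeGrid.mid; linarith
  rcases lt_or_ge s (G.mid m) with h | h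
  · rcases Nat.eq_zero_or_pos m with rfl | hpos
    · exact ⟨0, hM, Or.inl rfl, Or.inl rfl,
        Or.inr (h.trans ((hmid₂ 0 hm).trans (hmid₁ 1 (by omega))))⟩
    · obtain ⟨j, rfl⟩ : ∃ j, m = j + 1 := ⟨m - 1, by omega⟩
      exact ⟨j, by omega, Or.inr rfl, Or.inr ((hmid₂ j (by omega)).le.trans hs.1), Or.inr h⟩
  · rcases Nat.lt_or_ge (m + 1) G.M with h' | h'
    · exact ⟨m, by omega, Or.inl rfl, Or.inr h, Or.inr (hs.2.trans (hmid₁ _ h'))⟩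
    · obtain ⟨j, rfl⟩ : ∃ j, m = j + 1 := ⟨m - 1, by omega⟩
      exact ⟨j, by omega, Or.inr rfl, Or.inr ((hmid₂ j (by omega)).le.trans hs.1),
        Or.inl (by omega)⟩

/-- The pointwise error of the dual interpolant. -/
theorem norm_dualInterp_sub_sq_le [CompleteSpace V] [CompleteSpace H] {T : ℝ} (G : TimeGrid T)
    {w x : ℝ → H} {Y : ℝ → V} (hx : MemL2 T x) (hY : ContinuousOn Y (Icc 0 T))
    (hw : ∀ t ∈ Icc 0 T, w t = w 0 + ∫ s in (0:ℝ)..t, x s)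
    (hYw : ∀ t ∈ Icc 0 T, ι (Y t) = ι (Y 0) + ∫ s in (0:ℝ)..t, w s)
    (yk : ℝ → V) {j : ℕ} {s : ℝ} (hj : j + 2 ≤ G.M) (hs : s ∈ Icc (G.t j) (G.t (j + 2)))
    (h₁ : j = 0 ∨ G.mid j ≤ s) (h₂ : j + 2 = G.M ∨ s < G.mid (j + 1)) :
    ‖ι (G.dualInterp yk s) - ι (Y s)‖ ^ 2
      ≤ 12 * ‖ι (yk (G.mid j) - mean G Y j)‖ ^ 2
        + 12 * ‖ι (yk (G.mid (j + 1)) - mean G Y (j + 1))‖ ^ 2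
        + 75 * ((G.t (j + 2) - G.t j) ^ 3 * ∫ s in G.t j..G.t (j + 2), ‖x s‖ ^ 2) := by
  have l₁ := G.lt j (by omega)
  have l₂ : G.t (j + 1) < G.t (j + 2) := G.lt (j + 1) (by omega)
  have ha := G.t_nonneg (m := j) (by omega)
  have hb := G.t_le hj
  have hhc : ContinuousOn (fun t => ι (Y t)) (Icc 0 T) := ι.continuous.comp_continuousOn hY
  have hmean : ∀ i, i + 1 ≤ G.M → ι (mean G Y i)
      = (G.t (i + 1) - G.t i)⁻¹ • ∫ t in G.t i..G.t (i + 1), ι (Y t) := by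
    intro i hi
    rw [mean, map_smul, ι.intervalIntegral_comp_comm ((memL2_of_continuousOn hY).intervalIntegrable
      (G.t_mem (by omega)) (G.t_mem hi))]
  have hpos : 0 ≤ (G.t (j + 2) - G.t j) ^ 3 * ∫ s in G.t j..G.t (j + 2), ‖x s‖ ^ 2 :=
    mul_nonneg (pow_nonneg (by linarith) 3)
      (intervalIntegral.integral_nonneg (by linarith) fun s _ => sq_nonneg _)
  have hmm : G.mid (j + 1) - G.mid j = (G.t (j + 2) - G.t j) / 2 := by
    simp only [TimeGrid.mid]; ring
  rw [G.dualInterp_eq yk hj h₁ h₂, map_add, map_smul, map_sub, map_sub, map_sub,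
    ← Real.sq_sqrt hpos]
  refine norm_interp_sq_le (a := G.t j) (g := ι (Y (G.t j))) (η := w (G.t j)) ?_ ?_ ?_ rfl rfl rfl
    ?_ ?_ ?_
  · linarith
  -- Midpoints are half of t_{j+2} - t_j apart, so the relative coordinate stays in [-1, 2] on the
  -- whole double interval, extrapolated parts included.
  · rw [hmm, le_div_iff₀ (by linarith)]
    simp only [TimeGrid.mid]
    linarith [hs.1]
  · rw [hmm, div_le_iff₀ (by linarith)]
    simp only [TimeGrid.mid]
    linarith [hs.2]
  · rw [hmean j (by omega)]
    exact norm_mean_sub_sub_smul_le hx hw hYw hhc ha hb le_rfl l₁ l₂.le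
  · rw [hmean (j + 1) hj]
    exact norm_mean_sub_sub_smul_le hx hw hYw hhc ha hb l₁.le l₂ le_rfl
  · exact norm_sub_sub_smul_le hx hw hYw ha hb hs

end Interpolation

/-! ### Summing the interpolation error over the grid -/

section InterpolationSum

variable {V H : Type*} [NormedAddCommGroup V] [InnerProductSpace ℝ V]
  [NormedAddCommGroup H] [InnerProductSpace ℝ H] {ι : V →L[ℝ] H}

theorem TimeGrid.exists_mem_Ico {T : ℝ} (G : TimeGrid T) {s : ℝ} (hs : s ∈ Ico 0 T) :
    ∃ m < G.M, s ∈ Ico (G.t m) (G.t (m + 1)) := by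
  classical
  have hex : ∃ m, s < G.t m := ⟨G.M, hs.2.trans_eq G.last.symm⟩
  have h := Nat.find_spec hex
  have hle : Nat.find hex ≤ G.M := Nat.find_min' hex (hs.2.trans_eq G.last.symm)
  have hpos : Nat.find hex ≠ 0 := fun h0 => by
    rw [h0, G.zero] at h
    exact absurd hs.1 (not_le.mpr h)
  obtain ⟨m, hm⟩ : ∃ m, Nat.find hex = m + 1 := ⟨Nat.find hex - 1, by omega⟩
  refine ⟨m, by omega, not_lt.mp (Nat.find_min hex (by omega)), ?_⟩
  rwa [← hm]

/-- As a lower integral the squared norm can be bounded piece by piece without measurability of u.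
-/
theorem normL2_sq_eq_lintegral {X : Type*} [NormedAddCommGroup X] (T : ℝ) (u : ℝ → X) :
    normL2 T u ^ 2 = ∫⁻ t in Ioo 0 T, ENNReal.ofReal (‖u t‖ ^ 2) := by
  have h := eLpNorm_nnreal_pow_eq_lintegral (f := u) (μ := volume.restrict (Ioo 0 T))
    (p := 2) two_ne_zero
  have h2 : ((2 : NNReal) : ℝ) = ((2 : ℕ) : ℝ) := by norm_num
  rw [h2] at h
  simp only [ENNReal.rpow_natCast] at h
  rw [normL2]
  refine h.trans (lintegral_congr fun t => ?_)
  rw [ENNReal.ofReal_pow (norm_nonneg _), ofReal_norm]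

/-- A function that is bounded on each subinterval. -/
theorem TimeGrid.normL2_sq_le {X : Type*} [NormedAddCommGroup X] {T : ℝ} (G : TimeGrid T)
    {u : ℝ → X} {D : ℕ → ℝ} (hD : ∀ m, 0 ≤ D m)
    (hu : ∀ m < G.M, ∀ s ∈ Ico (G.t m) (G.t (m + 1)), ‖u s‖ ^ 2 ≤ D m) :
    normL2 T u ^ 2 ≤ ENNReal.ofReal (∑ m ∈ Finset.range G.M, G.step m * D m) := by
  rw [normL2_sq_eq_lintegral]
  have hcover : Ioo 0 T ⊆ ⋃ m : Fin G.M, Ico (G.t m) (G.t (m + 1)) := by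
    intro s hs
    obtain ⟨m, hm, hsm⟩ := G.exists_mem_Ico (Ioo_subset_Ico_self hs)
    exact mem_iUnion.mpr ⟨⟨m, hm⟩, hsm⟩
  refine (lintegral_mono_set hcover).trans ((lintegral_iUnion_le _ _).trans ?_)
  rw [tsum_fintype, ENNReal.ofReal_sum_of_nonneg fun m hm =>
    mul_nonneg (G.step_pos (Finset.mem_range.mp hm)).le (hD m),
    ← Fin.sum_univ_eq_sum_range (fun m => ENNReal.ofReal (G.step m * D m))]
  refine Finset.sum_le_sum fun m _ => ?_
  calc ∫⁻ s in Ico (G.t m) (G.t (m + 1)), ENNReal.ofReal (‖u s‖ ^ 2)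
      ≤ ∫⁻ _ in Ico (G.t m) (G.t (m + 1)), ENNReal.ofReal (D m) :=
        setLIntegral_mono' measurableSet_Ico fun s hs => ENNReal.ofReal_le_ofReal (hu m m.2 s hs)
    _ = ENNReal.ofReal (G.step m * D m) := by
        rw [setLIntegral_const, Real.volume_Ico, mul_comm,
          ENNReal.ofReal_mul (G.step_pos m.2).le]
        rfl

theorem sum_range_pred_le {N : ℕ} {u : ℕ → ℝ} (hu : ∀ m < N + 1, 0 ≤ u m) :
    ∑ j ∈ Finset.range N, u j ≤ ∑ j ∈ Finset.range (N + 1), u j ∧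
      ∑ j ∈ Finset.range N, u (j + 1) ≤ ∑ j ∈ Finset.range (N + 1), u j := by
  constructor
  · rw [Finset.sum_range_succ]
    linarith [hu N (by omega)]
  · rw [Finset.sum_range_succ']
    linarith [hu 0 (by omega)]

/-- The error of the dual interpolant in `L²(I, H)`. -/
theorem normL2_dualInterp_sub_sq_le [CompleteSpace V] [CompleteSpace H] {T : ℝ} (G : TimeGrid T)
    (hM : 2 ≤ G.M) {c₁ c₂ : ℝ} (hc₁ : 0 < c₁) (hG : G.IsQuasiUniform c₁ c₂)
    {w x : ℝ → H} {Y : ℝ → V} (hx : MemL2 T x) (hY : ContinuousOn Y (Icc 0 T))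
    (hw : ∀ t ∈ Icc 0 T, w t = w 0 + ∫ s in (0:ℝ)..t, x s)
    (hYw : ∀ t ∈ Icc 0 T, ι (Y t) = ι (Y 0) + ∫ s in (0:ℝ)..t, w s) (yk : ℝ → V) :
    normL2 T (fun t => ι (G.dualInterp yk t) - ι (Y t)) ^ 2 ≤ ENNReal.ofReal
      (12 * (2 + c₁⁻¹ + c₂) * (∑ m ∈ Finset.range G.M,
          G.step m * ‖ι (yk (G.mid m) - mean G Y m)‖ ^ 2)
        + 2400 * G.width ^ 4 * ∫ s in (0:ℝ)..T, ‖x s‖ ^ 2) := by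
  obtain ⟨N, hN⟩ : ∃ N, G.M = N + 1 := ⟨G.M - 1, by omega⟩
  set e : ℕ → ℝ := fun m => ‖ι (yk (G.mid m) - mean G Y m)‖ ^ 2 with he
  set z : ℕ → ℝ := fun m => ∫ s in G.t m..G.t (m + 1), ‖x s‖ ^ 2 with hz
  set L : ℕ → ℝ := fun j => G.step j + G.step (j + 1) with hL
  -- B j is the pointwise bound on the j-th dual piece. There are N = M - 1 such pieces; the value
  -- zero beyond them lets sums run over all subintervals.
  set B : ℕ → ℝ := fun j => if j < N then
    12 * e j + 12 * e (j + 1) + 75 * (L j ^ 3 * (z j + z (j + 1))) else 0 with hB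
  have he0 : ∀ m, 0 ≤ e m := fun m => sq_nonneg _
  have hz0 : ∀ m < N + 1, 0 ≤ z m := fun m hm =>
    intervalIntegral.integral_nonneg (G.lt m (by omega)).le fun s _ => sq_nonneg _
  have hk : ∀ m < N + 1, 0 < G.step m := fun m hm => G.step_pos (by omega)
  have hB0 : ∀ j, 0 ≤ B j := by
    intro j
    simp only [hB]
    split_ifs with hj
    · have h1 := hk j (by omega)
      have h2 := hk (j + 1) (by omega)
      have h3 := hz0 j (by omega)
      have h4 := hz0 (j + 1) (by omega)
      have h5 := he0 j
      have h6 := he0 (j + 1)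
      positivity
    · exact le_rfl
  -- On a primal subinterval either of two dual pieces may be active, so both bounds are added.
  set D : ℕ → ℝ := fun m => B m + if m = 0 then 0 else B (m - 1) with hDdef
  have hD0 : ∀ m, 0 ≤ D m := by
    intro m
    simp only [hDdef]
    split_ifs
    · linarith [hB0 m]
    · linarith [hB0 m, hB0 (m - 1)]
  have hpoint : ∀ m < G.M, ∀ s ∈ Ico (G.t m) (G.t (m + 1)),
      ‖ι (G.dualInterp yk s) - ι (Y s)‖ ^ 2 ≤ D m := by
    intro m hm s hs
    obtain ⟨j, hj, hjm, h₁, h₂⟩ := G.exists_dual_interval hM hm hs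
    have hsJ : s ∈ Icc (G.t j) (G.t (j + 2)) := by
      rcases hjm with rfl | rfl
      · exact ⟨hs.1, hs.2.le.trans (G.t_le_t (by omega) hj)⟩
      · exact ⟨(G.t_le_t (by omega) (by omega)).trans hs.1, hs.2.le⟩
    have h := norm_dualInterp_sub_sq_le (ι := ι) G hx hY hw hYw yk hj hsJ h₁ h₂
    have hLj : G.t (j + 2) - G.t j = L j := by simp only [hL, TimeGrid.step]; ring
    have hzj : ∫ s in G.t j..G.t (j + 2), ‖x s‖ ^ 2 = z j + z (j + 1) :=
      (intervalIntegral.integral_add_adjacent_intervals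
        (hx.intervalIntegrable_norm_sq (G.t_mem (by omega)) (G.t_mem (by omega)))
        (hx.intervalIntegrable_norm_sq (G.t_mem (by omega)) (G.t_mem (by omega)))).symm
    rw [hLj, hzj] at h
    have hBj : ‖ι (G.dualInterp yk s) - ι (Y s)‖ ^ 2 ≤ B j := by
      simp only [hB]
      rwa [if_pos (by omega)]
    refine hBj.trans ?_
    simp only [hDdef]
    rcases hjm with rfl | rfl
    · split_ifs
      · linarith
      · linarith [hB0 (j - 1)]
    · rw [if_neg (by omega), Nat.add_sub_cancel]
      linarith [hB0 (j + 1)]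
  refine (G.normL2_sq_le hD0 hpoint).trans (ENNReal.ofReal_le_ofReal ?_)
  have hsum : ∑ m ∈ Finset.range G.M, G.step m * D m = ∑ j ∈ Finset.range N, L j * B j := by
    have h1 : ∑ m ∈ Finset.range (N + 1), G.step m * B m
        = ∑ j ∈ Finset.range N, G.step j * B j := by
      rw [Finset.sum_range_succ]
      simp [hB]
    have h2 : ∑ m ∈ Finset.range (N + 1), G.step m * (if m = 0 then 0 else B (m - 1))
        = ∑ j ∈ Finset.range N, G.step (j + 1) * B j := by
      rw [Finset.sum_range_succ']
      simp
    simp only [hDdef, mul_add, hN, Finset.sum_add_distrib, hL, add_mul]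
    rw [h1, h2]
  -- The step ratios let L j be traded for either of its two steps, as needed for e j and e (j+1).
  -- For the Taylor part L j ≤ 2k gives 75 · 16 = 1200; each z is counted at most twice, whence
  -- 2400.
  have hterm : ∀ j ∈ Finset.range N, L j * B j ≤ 12 * (1 + c₁⁻¹) * (G.step j * e j)
      + 12 * (1 + c₂) * (G.step (j + 1) * e (j + 1))
      + 1200 * G.width ^ 4 * z j + 1200 * G.width ^ 4 * z (j + 1) := by
    intro j hj
    have hj' := Finset.mem_range.mp hj
    have k₁ := hk j (by omega)
    have k₂ := hk (j + 1) (by omega)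
    obtain ⟨q₁, q₂⟩ := hG j (by omega)
    rw [le_div_iff₀ k₂] at q₁
    rw [div_le_iff₀ k₂] at q₂
    have q₁' : G.step (j + 1) ≤ c₁⁻¹ * G.step j := by
      rw [inv_mul_eq_div, le_div_iff₀ hc₁]
      linarith
    have hL0 : 0 ≤ L j := by simp only [hL]; linarith
    have hL1 : L j ≤ (1 + c₁⁻¹) * G.step j := by simp only [hL]; linarith
    have hL2 : L j ≤ (1 + c₂) * G.step (j + 1) := by simp only [hL]; linarith
    have hL3 : L j ≤ 2 * G.width := by
      have := G.step_le_width (m := j) (by omega)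
      have := G.step_le_width (m := j + 1) (by omega)
      simp only [hL]; linarith
    have hL4 : L j ^ 4 ≤ 16 * G.width ^ 4 :=
      (pow_le_pow_left₀ hL0 hL3 4).trans_eq (by ring)
    have hzz : 0 ≤ z j + z (j + 1) := add_nonneg (hz0 j (by omega)) (hz0 (j + 1) (by omega))
    have m1 := mul_le_mul_of_nonneg_right hL1 (he0 j)
    have m2 := mul_le_mul_of_nonneg_right hL2 (he0 (j + 1))
    have m3 := mul_le_mul_of_nonneg_right hL4 hzz
    have hBj : B j = 12 * e j + 12 * e (j + 1) + 75 * (L j ^ 3 * (z j + z (j + 1))) := if_pos hj'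
    rw [hBj]
    linarith
  have hE := sum_range_pred_le (N := N) (u := fun m => G.step m * e m)
    fun m hm => mul_nonneg (hk m hm).le (he0 m)
  have hZ := sum_range_pred_le (N := N) (u := z) hz0
  have hZ' : ∑ m ∈ Finset.range (N + 1), z m = ∫ s in (0:ℝ)..T, ‖x s‖ ^ 2 := by
    rw [← hN]; exact G.sum_integral_norm_sq hx
  rw [hsum]
  refine (Finset.sum_le_sum hterm).trans ?_
  simp only [Finset.sum_add_distrib, ← Finset.mul_sum]
  rw [← hZ', hN]
  have hc₁' : 0 < c₁⁻¹ := inv_pos.mpr hc₁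
  have hc₂ : 0 < 1 + c₂ := by
    have h := hG 0 (by omega)
    have := hc₁.trans_le (h.1.trans h.2)
    linarith
  have n1 := mul_le_mul_of_nonneg_left hE.1 (by positivity : 0 ≤ 12 * (1 + c₁⁻¹))
  have n2 := mul_le_mul_of_nonneg_left hE.2 (by positivity : 0 ≤ 12 * (1 + c₂))
  have n3 := mul_le_mul_of_nonneg_left hZ.1 (by positivity : 0 ≤ 1200 * G.width ^ 4)
  have n4 := mul_le_mul_of_nonneg_left hZ.2 (by positivity : 0 ≤ 1200 * G.width ^ 4)
  linarith

end InterpolationSum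

/-! ### The Laplacian on `H¹₀(Ω)` -/

section Laplace

open scoped InnerProductSpace

variable {n : ℕ} {Ω : Set (Space n)}

theorem inner_H10 (u v : H10 Ω) : ⟪u, v⟫_ℝ = ⟪val u, val v⟫_ℝ + aForm u v := rfl

/-- The H¹ inner product is that of a Hilbert sum, so removing the L² part leaves the Dirichlet
form. This is how the abstract results reach H¹₀(Ω). -/
theorem energy_val (u v : H10 Ω) : energy val u v = aForm u v := by
  rw [energy_apply, inner_H10, add_sub_cancel_left]

theorem norm_val_le (v : H10 Ω) : ‖val v‖ ≤ ‖v‖ := by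
  have h := inner_H10 v v
  rw [real_inner_self_eq_norm_sq, real_inner_self_eq_norm_sq, aForm,
    real_inner_self_eq_norm_sq] at h
  exact le_of_sq_le_sq (by nlinarith [sq_nonneg ‖grad v‖]) (norm_nonneg _)

theorem inner_gradient_left {φ : Space n → ℝ} (x y : Space n) :
    ⟪gradient φ x, y⟫_ℝ = fderiv ℝ φ x y := by
  rw [gradient, InnerProductSpace.toDual_symm_apply]

theorem inner_gradient_gradient (φ ψ : Space n → ℝ) (x : Space n) :
    ⟪gradient φ x, gradient ψ x⟫_ℝ
      = ∑ i, fderiv ℝ φ x (EuclideanSpace.basisFun (Fin n) ℝ i)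
          * fderiv ℝ ψ x (EuclideanSpace.basisFun (Fin n) ℝ i) := by
  rw [← (EuclideanSpace.basisFun (Fin n) ℝ).sum_inner_mul_inner]
  refine Finset.sum_congr rfl fun i _ => ?_
  rw [inner_gradient_left, real_inner_comm, inner_gradient_left]

namespace IsTestFunction

variable {φ ψ : Space n → ℝ}

theorem continuous_fderiv_apply (hφ : IsTestFunction Ω φ) (v : Space n) :
    Continuous (fun x => fderiv ℝ φ x v) :=
  (hφ.smooth.continuous_fderiv (by simp)).clm_apply continuous_const

theorem continuous_gradient (hφ : IsTestFunction Ω φ) : Continuous (gradient φ) :=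
  (InnerProductSpace.toDual ℝ (Space n)).symm.continuous.comp
    (hφ.smooth.continuous_fderiv (by simp))

theorem hasCompactSupport_gradient (hφ : IsTestFunction Ω φ) : HasCompactSupport (gradient φ) :=
  (hφ.compact.fderiv (𝕜 := ℝ)).comp_left (g := (InnerProductSpace.toDual ℝ (Space n)).symm)
    (map_zero _)

theorem contDiff_fderiv_apply (hφ : IsTestFunction Ω φ) (v : Space n) :
    ContDiff ℝ ∞ (fun x => fderiv ℝ φ x v) :=
  (hφ.smooth.fderiv_right (m := ∞) (by simp)).clm_apply contDiff_const

theorem hasCompactSupport_fderiv_apply (hφ : IsTestFunction Ω φ) (v : Space n) :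
    HasCompactSupport (fun x => fderiv ℝ φ x v) := hφ.compact.fderiv_apply (𝕜 := ℝ) v

theorem laplacian_eq (hφ : IsTestFunction Ω φ) (x : Space n) :
    Laplacian.laplacian φ x = ∑ i, fderiv ℝ
      (fun y => fderiv ℝ φ y (EuclideanSpace.basisFun (Fin n) ℝ i)) x
        (EuclideanSpace.basisFun (Fin n) ℝ i) := by
  rw [InnerProductSpace.laplacian_eq_iteratedFDeriv_orthonormalBasis φ
    (EuclideanSpace.basisFun (Fin n) ℝ)]
  refine Finset.sum_congr rfl fun i _ => ?_
  rw [iteratedFDeriv_two_apply]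
  have hd : DifferentiableAt ℝ (fderiv ℝ φ) x :=
    ((hφ.smooth.fderiv_right (m := ∞) (by simp)).differentiable (by simp)).differentiableAt
  rw [fderiv_clm_apply hd (differentiableAt_const _)]
  simp

theorem continuous_laplacian (hφ : IsTestFunction Ω φ) : Continuous (Laplacian.laplacian φ) := by
  rw [funext hφ.laplacian_eq]
  refine continuous_finsetSum _ fun i _ => ?_
  exact ((hφ.contDiff_fderiv_apply _).continuous_fderiv (by simp)).clm_apply continuous_const

theorem hasCompactSupport_laplacian (hφ : IsTestFunction Ω φ) :
    HasCompactSupport (Laplacian.laplacian φ) := by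
  refine HasCompactSupport.intro hφ.compact fun x hx => ?_
  rw [hφ.laplacian_eq]
  refine Finset.sum_eq_zero fun i _ => ?_
  have h := (hφ.hasCompactSupport_fderiv_apply (EuclideanSpace.basisFun (Fin n) ℝ i))
  rw [image_eq_zero_of_notMem_tsupport (f := fderiv ℝ (fun y => fderiv ℝ φ y
    (EuclideanSpace.basisFun (Fin n) ℝ i))) fun h' => hx ?_, zero_apply]
  exact tsupport_fderiv_apply_subset ℝ _ (tsupport_fderiv_subset ℝ h')

/-- Green's formula for test functions. -/
theorem integral_mul_laplacian (hφ : IsTestFunction Ω φ) (hψ : IsTestFunction Ω ψ) :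
    ∫ x, ψ x * Laplacian.laplacian φ x = -∫ x, ⟪gradient φ x, gradient ψ x⟫_ℝ := by
  set b := EuclideanSpace.basisFun (Fin n) ℝ
  have i1 : ∀ i, Integrable fun x => ψ x * fderiv ℝ (fun y => fderiv ℝ φ y (b i)) x (b i) :=
    fun i => (hψ.smooth.continuous.mul (((hφ.contDiff_fderiv_apply _).continuous_fderiv
      (by simp)).clm_apply continuous_const)).integrable_of_hasCompactSupport hψ.compact.mul_right
  have i2 : ∀ i, Integrable fun x => fderiv ℝ ψ x (b i) * fderiv ℝ φ x (b i) := fun i =>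
    ((hψ.continuous_fderiv_apply _).mul
      (hφ.continuous_fderiv_apply _)).integrable_of_hasCompactSupport
      (hψ.hasCompactSupport_fderiv_apply _).mul_right
  have i3 : ∀ i, Integrable fun x => ψ x * fderiv ℝ φ x (b i) := fun i =>
    (hψ.smooth.continuous.mul (hφ.continuous_fderiv_apply _)).integrable_of_hasCompactSupport
      hψ.compact.mul_right
  simp only [hφ.laplacian_eq, Finset.mul_sum, inner_gradient_gradient]
  rw [integral_finsetSum _ fun i _ => i1 i,
    integral_finsetSum _ fun i _ => by simpa only [mul_comm] using i2 i, ← Finset.sum_neg_distrib]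
  refine Finset.sum_congr rfl fun i _ => ?_
  rw [integral_mul_fderiv_eq_neg_fderiv_mul_of_integrable (i2 i) (i1 i) (i3 i)
    (fun x _ => (hψ.smooth.differentiable (by simp)).differentiableAt)
    (fun x _ => ((hφ.contDiff_fderiv_apply _).differentiable (by simp)).differentiableAt)]
  simp only [mul_comm]
  rfl

theorem memLp (hφ : IsTestFunction Ω φ) : MemLp φ 2 (volume.restrict Ω) :=
  (hφ.smooth.continuous.memLp_of_hasCompactSupport hφ.compact).restrict Ω

theorem memLp_gradient (hφ : IsTestFunction Ω φ) : MemLp (gradient φ) 2 (volume.restrict Ω) :=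
  (hφ.continuous_gradient.memLp_of_hasCompactSupport hφ.hasCompactSupport_gradient).restrict Ω

theorem memLp_laplacian (hφ : IsTestFunction Ω φ) :
    MemLp (Laplacian.laplacian φ) 2 (volume.restrict Ω) :=
  (hφ.continuous_laplacian.memLp_of_hasCompactSupport hφ.hasCompactSupport_laplacian).restrict Ω

/-- A test function as an element of `H¹₀(Ω)`. -/
def toH10 (hφ : IsTestFunction Ω φ) : H10 Ω :=
  ⟨WithLp.toLp 2 (hφ.memLp.toLp φ, hφ.memLp_gradient.toLp (gradient φ)),
    Submodule.le_topologicalClosure _ (Submodule.subset_span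
      ⟨φ, hφ, hφ.memLp.coeFn_toLp, hφ.memLp_gradient.coeFn_toLp⟩)⟩

theorem val_toH10 (hφ : IsTestFunction Ω φ) : val hφ.toH10 = hφ.memLp.toLp φ := rfl

theorem grad_toH10 (hφ : IsTestFunction Ω φ) :
    grad hφ.toH10 = hφ.memLp_gradient.toLp (gradient φ) := rfl

theorem inner_toLp {ψ : Space n → ℝ} (hψ : MemLp ψ 2 (volume.restrict Ω)) (g : L2 Ω) :
    ⟪g, hψ.toLp ψ⟫_ℝ = ∫ x in Ω, g x * ψ x := by
  rw [L2.inner_def]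
  refine integral_congr_ae ?_
  filter_upwards [hψ.coeFn_toLp] with x hx
  rw [hx, mul_comm]
  rfl

end IsTestFunction

/-- A continuous linear functional that vanishes on test functions vanishes on `H¹₀(Ω)`. -/
theorem eq_zero_of_forall_testFunction {L : WithLp 2 (L2 Ω × L2Vec Ω) →L[ℝ] ℝ}
    (hL : ∀ φ : Space n → ℝ, ∀ hφ : IsTestFunction Ω φ, L hφ.toH10 = 0) (v : H10 Ω) : L v = 0 := by
  have h : H10Submodule Ω ≤ L.ker := by
    refine Submodule.topologicalClosure_minimal _ (Submodule.span_le.mpr ?_) L.isClosed_ker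
    rintro p ⟨φ, hφ, h1, h2⟩
    have hp : p = hφ.toH10 := by
      refine WithLp.ofLp_injective 2 (Prod.ext ?_ ?_)
      · exact Lp.ext (h1.trans hφ.memLp.coeFn_toLp.symm)
      · exact Lp.ext (h2.trans hφ.memLp_gradient.coeFn_toLp.symm)
    rw [hp]
    exact hL φ hφ
  exact h v.2

theorem setIntegral_eq_of_tsupport {f : Space n → ℝ} (h : ∀ x, x ∉ Ω → f x = 0) :
    ∫ x in Ω, f x = ∫ x, f x := setIntegral_eq_integral_of_forall_compl_eq_zero h

/-- Green's formula for `u ∈ H¹₀(Ω)` and a test function. -/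
theorem integral_val_mul_laplacian {φ : Space n → ℝ} (hφ : IsTestFunction Ω φ) (u : H10 Ω) :
    ∫ x in Ω, val u x * Laplacian.laplacian φ x = -aForm u hφ.toH10 := by
  -- L is the defect in Green's formula. It is continuous in (u, ∇u), so it suffices that it vanish
  -- on test functions.
  let L : WithLp 2 (L2 Ω × L2Vec Ω) →L[ℝ] ℝ :=
    (innerSL ℝ (hφ.memLp_laplacian.toLp _)).comp (WithLp.fstL 2 ℝ (L2 Ω) (L2Vec Ω))
      + (innerSL ℝ (grad hφ.toH10)).comp (WithLp.sndL 2 ℝ (L2 Ω) (L2Vec Ω))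
  have hL : ∀ v : H10 Ω, L v
      = ⟪hφ.memLp_laplacian.toLp _, val v⟫_ℝ + ⟪grad hφ.toH10, grad v⟫_ℝ := fun v => rfl
  have h0 := eq_zero_of_forall_testFunction (L := L) ?_ u
  · rw [hL, real_inner_comm, IsTestFunction.inner_toLp] at h0
    rw [aForm, real_inner_comm]
    linarith
  · intro ψ hψ
    rw [hL, real_inner_comm, IsTestFunction.inner_toLp, hψ.val_toH10, L2.inner_def]
    have e1 : ∫ x in Ω, (hψ.memLp.toLp ψ : Space n → ℝ) x * Laplacian.laplacian φ x
        = ∫ x in Ω, ψ x * Laplacian.laplacian φ x := by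
      refine integral_congr_ae ?_
      filter_upwards [hψ.memLp.coeFn_toLp] with x hx
      rw [hx]
    have e2 : ∫ x in Ω, ⟪(grad hφ.toH10 : Space n → Space n) x,
        (grad hψ.toH10 : Space n → Space n) x⟫_ℝ
        = ∫ x in Ω, ⟪gradient φ x, gradient ψ x⟫_ℝ := by
      refine integral_congr_ae ?_
      filter_upwards [hφ.memLp_gradient.coeFn_toLp, hψ.memLp_gradient.coeFn_toLp] with x h1 h2
      rw [hφ.grad_toH10, hψ.grad_toH10, h1, h2]
    rw [e1, e2, setIntegral_eq_of_tsupport, setIntegral_eq_of_tsupport,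
      hφ.integral_mul_laplacian hψ, neg_add_cancel]
    · intro x hx
      have hz : fderiv ℝ ψ x = 0 := image_eq_zero_of_notMem_tsupport
        fun h => hx (hψ.support (tsupport_fderiv_subset ℝ h))
      rw [real_inner_comm, inner_gradient_left, hz, zero_apply]
    · intro x hx
      rw [image_eq_zero_of_notMem_tsupport fun h => hx (hψ.support h), zero_mul]

/-- The distributional Laplacian of `u ∈ H¹₀(Ω)` in variational form. -/
theorem hasLaplacian_val_iff (u : H10 Ω) (g : L2 Ω) :
    HasLaplacian (val u) g ↔ ∀ v, aForm u v = -⟪g, val v⟫_ℝ := by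
  have hg : ∀ φ : Space n → ℝ, ∀ hφ : IsTestFunction Ω φ,
      ∫ x in Ω, g x * φ x = ⟪g, val hφ.toH10⟫_ℝ := fun φ hφ => by
    rw [hφ.val_toH10, IsTestFunction.inner_toLp]
  constructor
  · intro h v
    let L : WithLp 2 (L2 Ω × L2Vec Ω) →L[ℝ] ℝ :=
      (innerSL ℝ g).comp (WithLp.fstL 2 ℝ (L2 Ω) (L2Vec Ω))
        + (innerSL ℝ (grad u)).comp (WithLp.sndL 2 ℝ (L2 Ω) (L2Vec Ω))
    have hL : ∀ v : H10 Ω, L v = ⟪g, val v⟫_ℝ + aForm u v := fun v => rfl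
    have h0 := eq_zero_of_forall_testFunction (L := L) (fun φ hφ => by
      rw [hL, ← hg, ← h φ hφ, integral_val_mul_laplacian hφ, neg_add_cancel]) v
    rw [hL] at h0
    linarith
  · intro h φ hφ
    rw [integral_val_mul_laplacian hφ, h, neg_neg, hg φ hφ]

end Laplace

/-! ### Piecewise affine test functions and the discrete equation -/

namespace TimeGrid

variable {T : ℝ} (G : TimeGrid T) {V : Type*} [NormedAddCommGroup V] [NormedSpace ℝ V]

/-- The continuous piecewise affine function with nodal values `p`. -/
def linInterp (p : ℕ → V) (s : ℝ) : V :=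
  p 0 + ∑ i ∈ Finset.range G.M, max 0 (min 1 ((s - G.t i) / G.step i)) • (p (i + 1) - p i)

theorem continuous_linInterp (p : ℕ → V) : Continuous (G.linInterp p) := by
  unfold linInterp
  fun_prop

/-- On the m-th subinterval the earlier clamped ramps are saturated at 1 and telescope to p m - p 0,
while the later ones are still 0. -/
theorem linInterp_eq (p : ℕ → V) {m : ℕ} (hm : m < G.M) {s : ℝ}
    (hs : s ∈ Icc (G.t m) (G.t (m + 1))) :
    G.linInterp p s = p m + ((s - G.t m) / (G.t (m + 1) - G.t m)) • (p (m + 1) - p m) := by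
  have h0 : ∀ i ∈ Finset.range G.M, i ∉ Finset.range (m + 1) →
      max 0 (min 1 ((s - G.t i) / G.step i)) • (p (i + 1) - p i) = 0 := by
    intro i hi him
    rw [Finset.mem_range] at hi him
    have h1 : s - G.t i ≤ 0 := sub_nonpos.mpr (hs.2.trans (G.t_le_t (by omega) hi.le))
    rw [max_eq_left ((min_le_right _ _).trans
      (div_nonpos_of_nonpos_of_nonneg h1 (G.step_pos hi).le)), zero_smul]
  have h1 : ∀ i ∈ Finset.range m,
      max 0 (min 1 ((s - G.t i) / G.step i)) • (p (i + 1) - p i) = p (i + 1) - p i := by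
    intro i hi
    rw [Finset.mem_range] at hi
    have h2 : G.t (i + 1) ≤ s := (G.t_le_t (by omega) hm.le).trans hs.1
    rw [min_eq_left, max_eq_right zero_le_one, one_smul]
    rw [le_div_iff₀ (G.step_pos (by omega)), one_mul, step]
    linarith
  have hk := G.step_pos hm
  rw [linInterp, ← Finset.sum_subset (Finset.range_subset_range.mpr hm) h0, Finset.sum_range_succ,
    Finset.sum_congr rfl h1, Finset.sum_range_sub, min_eq_right, max_eq_right]
  · rw [step]; abel
  · exact div_nonneg (sub_nonneg.mpr hs.1) hk.le
  · rw [div_le_one hk, step]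
    linarith [hs.2]

theorem linInterp_zero (p : ℕ → V) (hM : 0 < G.M) : G.linInterp p 0 = p 0 := by
  rw [G.linInterp_eq p hM ⟨G.zero.le, G.zero ▸ (G.lt 0 hM).le⟩, G.zero]
  simp

theorem linInterp_last (p : ℕ → V) (hM : 0 < G.M) : G.linInterp p T = p G.M := by
  obtain ⟨m, hm⟩ : ∃ m, G.M = m + 1 := ⟨G.M - 1, by omega⟩
  have hT : T = G.t (m + 1) := hm ▸ G.last.symm
  have hlt := G.lt m (by omega)
  rw [G.linInterp_eq p (m := m) (by omega) ⟨hlt.le.trans hT.ge, hT.le⟩,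
    show T - G.t m = G.t (m + 1) - G.t m by linarith, hm, div_self (sub_pos.mpr hlt).ne', one_smul,
    add_sub_cancel]

theorem isPiecewiseLinear_linInterp (p : ℕ → V) : G.IsPiecewiseLinear (G.linInterp p) := by
  refine ⟨(G.continuous_linInterp p).continuousOn, fun m hm => ?_⟩
  refine ⟨p m - (G.t m / (G.t (m + 1) - G.t m)) • (p (m + 1) - p m),
    (G.t (m + 1) - G.t m)⁻¹ • (p (m + 1) - p m), fun s hs => ?_⟩
  rw [G.linInterp_eq p hm (Ico_subset_Icc_self hs), smul_smul, sub_div, sub_smul, div_eq_mul_inv s]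
  abel

theorem deriv_linInterp (p : ℕ → V) {m : ℕ} (hm : m < G.M) {s : ℝ}
    (hs : s ∈ Ioo (G.t m) (G.t (m + 1))) :
    deriv (G.linInterp p) s = (G.t (m + 1) - G.t m)⁻¹ • (p (m + 1) - p m) := by
  have h1 : HasDerivAt (fun t => (t - G.t m) / (G.t (m + 1) - G.t m))
      (G.t (m + 1) - G.t m)⁻¹ s := by
    simpa [one_div] using ((hasDerivAt_id s).sub_const (G.t m)).div_const (G.t (m + 1) - G.t m)
  refine HasDerivAt.deriv ?_
  refine ((h1.smul_const (p (m + 1) - p m)).const_add (p m)).congr_of_eventuallyEq ?_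
  filter_upwards [Icc_mem_nhds hs.1 hs.2] with r hr using G.linInterp_eq p hm hr

end TimeGrid

/-- The formula for the derivative of an interpolant is available only between nodes, so endpoints
must be ignored. -/
theorem intervalIntegral_congr_of_Ioo {X : Type*} [NormedAddCommGroup X] [NormedSpace ℝ X] {a b : ℝ}
    (hab : a ≤ b) {u v : ℝ → X} (h : ∀ s ∈ Ioo a b, u s = v s) :
    ∫ s in a..b, u s = ∫ s in a..b, v s := by
  rw [intervalIntegral.integral_of_le hab, intervalIntegral.integral_of_le hab,
    integral_Ioc_eq_integral_Ioo, integral_Ioc_eq_integral_Ioo]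
  exact setIntegral_congr_fun measurableSet_Ioo h

theorem intervalIntegrable_congr_of_Ioo {X : Type*} [NormedAddCommGroup X] {a b : ℝ}
    (hab : a ≤ b) {u v : ℝ → X} (h : ∀ s ∈ Ioo a b, u s = v s)
    (hv : IntervalIntegrable v volume a b) : IntervalIntegrable u volume a b := by
  rw [intervalIntegrable_iff_integrableOn_Ioo_of_le hab] at hv ⊢
  exact hv.congr_fun (fun s hs => (h s hs).symm) measurableSet_Ioo

section DiscreteEquation

open scoped InnerProductSpace

/-- The left-hand side of the discrete equation for a piecewise affine test function. -/
theorem integral_linInterp_eq_sum {V H : Type*} [NormedAddCommGroup V] [InnerProductSpace ℝ V]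
    [NormedAddCommGroup H] [InnerProductSpace ℝ H] (ι : V →L[ℝ] H) {T : ℝ} (G : TimeGrid T)
    {yk : ℝ → V} (hpc : G.IsPiecewiseConst yk) (p : ℕ → V) :
    ∫ s in (0:ℝ)..T, (-⟪ι (deriv (G.linInterp p) s), ι (yk s)⟫_ℝ
        + energy ι (yk s) (G.linInterp p s))
      = ∑ m ∈ Finset.range G.M, (-⟪ι (p (m + 1) - p m), ι (yk (G.mid m))⟫_ℝ
        + G.step m * energy ι (yk (G.mid m)) ((1 / 2 : ℝ) • (p m + p (m + 1)))) := by
  have hyk : ∀ m < G.M, ∀ s ∈ Ico (G.t m) (G.t (m + 1)), yk s = yk (G.mid m) := by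
    intro m hm s hs
    obtain ⟨α, hα⟩ := hpc m hm
    have hlt := G.lt m hm
    rw [hα s hs, hα (G.mid m) ⟨by unfold TimeGrid.mid; linarith, by unfold TimeGrid.mid; linarith⟩]
  -- The part of the test function that is odd about the midpoint is isolated; paired with a
  -- constant it integrates to zero.
  have hl : ∀ m < G.M, ∀ s ∈ Ioo (G.t m) (G.t (m + 1)),
      -⟪ι (deriv (G.linInterp p) s), ι (yk s)⟫_ℝ + energy ι (yk s) (G.linInterp p s)
      = -((G.t (m + 1) - G.t m)⁻¹ * ⟪ι (p (m + 1) - p m), ι (yk (G.mid m))⟫_ℝ)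
        + (energy ι (yk (G.mid m)) ((1 / 2 : ℝ) • (p m + p (m + 1)))
        + (s - (G.t m + G.t (m + 1)) / 2)
          * ((G.t (m + 1) - G.t m)⁻¹ * energy ι (yk (G.mid m)) (p (m + 1) - p m))) := by
    intro m hm s hs
    have hk := G.step_pos hm
    rw [TimeGrid.step] at hk
    rw [G.deriv_linInterp p hm hs, hyk m hm s (Ioo_subset_Ico_self hs),
      G.linInterp_eq p hm (Ioo_subset_Icc_self hs), map_smul, real_inner_smul_left]
    congr 1
    have e : p m + ((s - G.t m) / (G.t (m + 1) - G.t m)) • (p (m + 1) - p m)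
        = (1 / 2 : ℝ) • (p m + p (m + 1)) + ((s - (G.t m + G.t (m + 1)) / 2)
          * (G.t (m + 1) - G.t m)⁻¹) • (p (m + 1) - p m) := by
      have : (s - G.t m) / (G.t (m + 1) - G.t m) = 1 / 2 + (s - (G.t m + G.t (m + 1)) / 2)
          * (G.t (m + 1) - G.t m)⁻¹ := by
        field_simp
        ring
      rw [this]
      module
    rw [e, map_add, map_smul (energy ι (yk (G.mid m))) (_ * _), smul_eq_mul, mul_assoc]
  have hc : ∀ m, Continuous fun s : ℝ =>
      -((G.t (m + 1) - G.t m)⁻¹ * ⟪ι (p (m + 1) - p m), ι (yk (G.mid m))⟫_ℝ)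
        + (energy ι (yk (G.mid m)) ((1 / 2 : ℝ) • (p m + p (m + 1)))
        + (s - (G.t m + G.t (m + 1)) / 2)
          * ((G.t (m + 1) - G.t m)⁻¹ * energy ι (yk (G.mid m)) (p (m + 1) - p m))) := by
    intro m
    fun_prop
  rw [← G.sum_integral fun m hm => intervalIntegrable_congr_of_Ioo (G.lt m hm).le (hl m hm)
    ((hc m).intervalIntegrable _ _)]
  refine Finset.sum_congr rfl fun m hm => ?_
  have hm' := Finset.mem_range.mp hm
  have hk := G.step_pos hm'
  rw [TimeGrid.step] at hk
  rw [intervalIntegral_congr_of_Ioo (G.lt m hm').le (hl m hm'),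
    intervalIntegral.integral_add intervalIntegrable_const
      (Continuous.intervalIntegrable (by fun_prop) _ _),
    intervalIntegral.integral_add intervalIntegrable_const
      (Continuous.intervalIntegrable (by fun_prop) _ _), intervalIntegral.integral_mul_const,
    integral_sub_mid, zero_mul, add_zero, intervalIntegral.integral_const,
    intervalIntegral.integral_const, smul_eq_mul, smul_eq_mul, mul_neg,
    mul_inv_cancel_left₀ hk.ne', TimeGrid.step]

/-- The right-hand side of the discrete equation for a piecewise affine test function. -/
theorem integral_inner_linInterp_eq_sum {V H : Type*} [NormedAddCommGroup V]
    [InnerProductSpace ℝ V] [NormedAddCommGroup H] [InnerProductSpace ℝ H] (ι : V →L[ℝ] H) {T : ℝ}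
    (G : TimeGrid T) {f : ℝ → H} (hf : MemL2 T f) (p : ℕ → V) :
    ∫ t in (0:ℝ)..T, ⟪f t, ι (G.linInterp p t)⟫_ℝ
      = ∑ m ∈ Finset.range G.M, ∫ t in G.t m..G.t (m + 1),
          ⟪f t, ι (p m + ((t - G.t m) / (G.t (m + 1) - G.t m)) • (p (m + 1) - p m))⟫_ℝ := by
  have hv : MemL2 T (fun t => ι (G.linInterp p t)) :=
    memL2_of_continuousOn (ι.continuous.comp (G.continuous_linInterp p)).continuousOn
  have hfv : IntegrableOn (fun t => ⟪f t, ι (G.linInterp p t)⟫_ℝ) (Ioc 0 T) := by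
    rw [integrableOn_Ioc_iff_integrableOn_Ioo]
    exact hf.integrable_inner hv
  have hfi : ∀ m < G.M, IntervalIntegrable (fun t => ⟪f t, ι (G.linInterp p t)⟫_ℝ) volume
      (G.t m) (G.t (m + 1)) := by
    intro m hm
    rw [intervalIntegrable_iff_integrableOn_Ioc_of_le (G.lt m hm).le]
    exact hfv.mono_set (Ioc_subset_Ioc (G.t_nonneg hm.le) (G.t_le (Nat.succ_le_of_lt hm)))
  rw [← G.sum_integral hfi]
  refine Finset.sum_congr rfl fun m hm => ?_
  have hm' := Finset.mem_range.mp hm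
  refine intervalIntegral_congr_of_Ioo (G.lt m hm').le fun s hs => ?_
  rw [G.linInterp_eq p hm' (Ioo_subset_Icc_self hs)]

variable {n : ℕ} {Ω : Set (Space n)}

theorem toHm1_apply (g : L2 Ω) (v : H10 Ω) : toHm1 g v = ⟪g, val v⟫_ℝ := rfl

/-- The discrete equation tested with the interpolant of nodal values that vanish at `T`. -/
theorem IsDiscreteSolution.sum_eq {T : ℝ} (hT : 0 < T) {G : TimeGrid T} {f : ℝ → L2 Ω}
    (hf : MemL2 T f) {κ : L2 Ω} {yk : ℝ → H10 Ω} {ykT : L2 Ω}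
    (h : IsDiscreteSolution G (fun t => toHm1 (f t)) κ yk ykT) {p : ℕ → H10 Ω} (hp : p G.M = 0) :
    ∑ m ∈ Finset.range G.M, (-⟪val (p (m + 1) - p m), val (yk (G.mid m))⟫_ℝ
        + G.step m * energy val (yk (G.mid m)) ((1 / 2 : ℝ) • (p m + p (m + 1))))
      = (∑ m ∈ Finset.range G.M, ∫ t in G.t m..G.t (m + 1),
          ⟪f t, val (p m + ((t - G.t m) / (G.t (m + 1) - G.t m)) • (p (m + 1) - p m))⟫_ℝ)
        + ⟪κ, val (p 0)⟫_ℝ := by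
  have hM : 0 < G.M := by
    rcases Nat.eq_zero_or_pos G.M with h0 | h0
    · have := G.last
      rw [h0, G.zero] at this
      exact absurd this hT.ne
    · exact h0
  have heq := h.equation (G.linInterp p) (G.isPiecewiseLinear_linInterp p)
  -- A test function vanishing at T eliminates the final value of the discrete solution.
  rw [formA, G.linInterp_last p hM, hp, map_zero, inner_zero_right, add_zero,
    G.linInterp_zero p hM, integral_Ioo_eq_intervalIntegral hT,
    integral_Ioo_eq_intervalIntegral hT] at heq
  simp only [← energy_val, toHm1_apply] at heq
  rw [← integral_linInterp_eq_sum val G h.piecewise p, heq,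
    integral_inner_linInterp_eq_sum val G hf p]

end DiscreteEquation

/-! ### Weak solutions -/

section Weak

open scoped InnerProductSpace

variable {n : ℕ} {Ω : Set (Space n)}

/-- Testing with v switched off at time s integrates the weak equation over (0, s). -/
theorem setIntegral_indicator_Iio {V : Type*} [Zero V] {T s : ℝ} (hs : s ∈ Ioo 0 T) (g : ℝ → V → ℝ)
    (hg : ∀ t, g t 0 = 0) (v : V) :
    ∫ t in Ioo 0 T, g t ((Iio s).indicator (fun _ => v) t) = ∫ t in (0:ℝ)..s, g t v := by
  have h : ∀ t, g t ((Iio s).indicator (fun _ => v) t) = (Iio s).indicator (fun t => g t v) t := by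
    intro t
    by_cases ht : t ∈ Iio s
    · rw [indicator_of_mem ht, indicator_of_mem ht]
    · rw [indicator_of_notMem ht, indicator_of_notMem ht, hg]
  simp only [h]
  rw [setIntegral_indicator measurableSet_Iio, intervalIntegral.integral_of_le hs.1.le,
    integral_Ioc_eq_integral_Ioo]
  congr 2
  ext t
  simp only [mem_inter_iff, mem_Ioo, mem_Iio]
  constructor
  · rintro ⟨⟨h1, _⟩, h3⟩; exact ⟨h1, h3⟩
  · rintro ⟨h1, h3⟩; exact ⟨⟨h1, h3.trans hs.2⟩, h3⟩

theorem MemL2.apply {V : Type*} [NormedAddCommGroup V] [NormedSpace ℝ V] {T : ℝ}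
    {u : ℝ → V →L[ℝ] ℝ} (hu : MemL2 T u) (v : V) : MemL2 T (fun t => u t v) :=
  hu.clm_comp (ContinuousLinearMap.apply ℝ ℝ v)

theorem continuous_toHm1 : Continuous (toHm1 : L2 Ω → Hm1 Ω) :=
  (innerSL ℝ).continuous.clm_comp continuous_const

/-- The time integral of the equation, tested with a fixed element. -/
theorem integrated_equation_of_integral_eq {V H : Type*} [NormedAddCommGroup V]
    [InnerProductSpace ℝ V] [CompleteSpace V] [NormedAddCommGroup H] [InnerProductSpace ℝ H]
    [CompleteSpace H] {ι : V →L[ℝ] H} {T s : ℝ} (hs : s ∈ Icc 0 T) {y' : ℝ → V →L[ℝ] ℝ} {y : ℝ → V}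
    {f : ℝ → H} (hy' : MemL2 T y') (hy : MemL2 T y) (hf : MemL2 T f) {κ : H} {v : V}
    (e : ∫ t in (0:ℝ)..s, (y' t v + energy ι (y t) v) = ∫ t in (0:ℝ)..s, ⟪f t, ι v⟫_ℝ)
    (hys : ⟪ι (y s), ι v⟫_ℝ = ⟪κ, ι v⟫_ℝ + (∫ t in (0:ℝ)..s, y' t) v) :
    ⟪ι (y s), ι v⟫_ℝ + energy ι (∫ t in (0:ℝ)..s, y t) v
      = ⟪κ + ∫ t in (0:ℝ)..s, f t, ι v⟫_ℝ := by
  have h0 : (0 : ℝ) ∈ Icc 0 T := left_mem_Icc.mpr (hs.1.trans hs.2)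
  have i1 := hy'.intervalIntegrable h0 hs
  have i2 := hy.intervalIntegrable h0 hs
  have i3 := hf.intervalIntegrable h0 hs
  have c1 := ContinuousLinearMap.intervalIntegral_apply i1 v
  have c2 := ((energy ι).flip v).intervalIntegral_comp_comm i2
  have c3 := (innerSL ℝ (ι v)).intervalIntegral_comp_comm i3
  have j1 := (hy'.apply v).intervalIntegrable h0 hs
  have j2 : IntervalIntegrable (fun t => energy ι (y t) v) volume 0 s :=
    (hy.clm_comp ((energy ι).flip v)).intervalIntegrable h0 hs
  have e3 : ∫ t in (0:ℝ)..s, ⟪f t, ι v⟫_ℝ = ∫ t in (0:ℝ)..s, innerSL ℝ (ι v) (f t) :=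
    intervalIntegral.integral_congr fun t _ => real_inner_comm _ _
  rw [intervalIntegral.integral_add j1 j2, e3, c3, ← c1] at e
  rw [hys, inner_add_left, add_assoc, real_inner_comm _ (∫ t in (0:ℝ)..s, f t)]
  exact congrArg _ ((congrArg _ c2.symm).trans e)

instance : CompleteSpace (H10 Ω) :=
  (Submodule.isClosed_topologicalClosure _).completeSpace_coe

/-- The time-integrated equation of a weak solution. -/
theorem IsWeakSolution.integrated_equation {T : ℝ} (hT : 0 < T) {f : ℝ → L2 Ω} (hf : MemL2 T f)
    {κ : L2 Ω} {y : ℝ → H10 Ω} (h : IsWeakSolution T (fun t => toHm1 (f t)) κ y) :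
    ∀ᵐ s ∂(volume.restrict (Ioo 0 T)), ∀ v, ⟪val (y s), val v⟫_ℝ
      + energy val (∫ t in (0:ℝ)..s, y t) v = ⟪κ + ∫ t in (0:ℝ)..s, f t, val v⟫_ℝ := by
  obtain ⟨y', hy', heq⟩ := h.equation
  have hinit : HasInitialValue T (fun t => toHm1 (val (y t))) (toHm1 κ) := by
    obtain ⟨c, hc, hcy, hc0⟩ := h.initial
    refine ⟨fun t => toHm1 (c t), continuous_toHm1.comp_continuousOn hc, ?_, congrArg toHm1 hc0⟩
    filter_upwards [hcy] with t ht
    rw [ht]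
  -- The primitive is taken in H⁻¹(Ω) before pairing with v, so the exceptional null set does not
  -- depend on v.
  filter_upwards [hy'.ae_eq_primitive hT hinit, self_mem_ae_restrict measurableSet_Ioo]
    with s hs hsI v
  have hv : MemL2 T ((Iio s).indicator fun _ => v) :=
    (memL2_of_continuousOn (T := T) (u := fun _ : ℝ => v) continuousOn_const).indicator
      measurableSet_Iio
  have e := heq _ hv
  simp only [← energy_val] at e
  rw [setIntegral_indicator_Iio hsI (fun t v => y' t v + energy val (y t) v)
      (fun t => by rw [map_zero, map_zero, add_zero]) v,
    setIntegral_indicator_Iio hsI (fun t v => toHm1 (f t) v) (fun t => map_zero _) v] at e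
  have hys : toHm1 (val (y s)) v = toHm1 κ v + (∫ t in (0:ℝ)..s, y' t) v :=
    congrArg (fun φ : Hm1 Ω => φ v) hs
  exact integrated_equation_of_integral_eq (Ioo_subset_Icc_self hsI) hy'.memL2_deriv h.memL2 hf
    e hys

end Weak

/-! ### Identification of the solution and the combined error estimate -/

section Main

open scoped InnerProductSpace

variable {V H : Type*} [NormedAddCommGroup V] [InnerProductSpace ℝ V]
  [NormedAddCommGroup H] [InnerProductSpace ℝ H] {ι : V →L[ℝ] H}
  [CompleteSpace V] [CompleteSpace H]

/-- A regular solution satisfies the time-integrated equation, and hence agrees with every other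
function that does. -/
theorem ae_eq_of_integrated_equation {T : ℝ} (hT : 0 < T) (hι : ∀ v, ‖ι v‖ ≤ ‖v‖)
    {F w : ℝ → H} {Y y : ℝ → V} {y₀ : H}
    (hF : ContinuousOn F (Icc 0 T)) (hw : ContinuousOn w (Icc 0 T))
    (hY : ContinuousOn Y (Icc 0 T))
    (hYw : ∀ t ∈ Icc 0 T, ι (Y t) = y₀ + ∫ s in (0:ℝ)..t, w s)
    (hE : ∀ t ∈ Icc 0 T, ∀ v, energy ι (Y t) v = ⟪F t - w t, ι v⟫_ℝ)
    (hy : MemL2 T y)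
    (h : ∀ᵐ s ∂(volume.restrict (Ioo 0 T)), ∀ v, ⟪ι (y s), ι v⟫_ℝ
      + energy ι (∫ t in (0:ℝ)..s, y t) v = ⟪y₀ + ∫ t in (0:ℝ)..s, F t, ι v⟫_ℝ) :
    ∀ᵐ t ∂(volume.restrict (Ioo 0 T)), ι (y t) = ι (Y t) := by
  have h0 : (0 : ℝ) ∈ Icc 0 T := left_mem_Icc.mpr hT.le
  have hYL := memL2_of_continuousOn hY
  have key := ae_eq_zero_of_integrated_equation hT hι (u := fun t => y t - Y t) (hy.sub hYL) ?_
  · filter_upwards [key] with t ht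
    rwa [map_sub, sub_eq_zero] at ht
  filter_upwards [h, self_mem_ae_restrict measurableSet_Ioo] with s hs hsI v
  have hsI' : s ∈ Icc 0 T := Ioo_subset_Icc_self hsI
  have iY := hYL.intervalIntegrable h0 hsI'
  have iF := (memL2_of_continuousOn hF).intervalIntegrable h0 hsI'
  have iw := (memL2_of_continuousOn hw).intervalIntegrable h0 hsI'
  -- Integrating A Y = F - w in time puts Y in the same time-integrated form as y, so uniqueness
  -- applies to the difference.
  have e1 : energy ι (∫ t in (0:ℝ)..s, Y t) v = ⟪∫ t in (0:ℝ)..s, (F t - w t), ι v⟫_ℝ := by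
    have c1 := ((energy ι).flip v).intervalIntegral_comp_comm iY
    have c2 := (innerSL ℝ (ι v)).intervalIntegral_comp_comm (iF.sub iw)
    rw [real_inner_comm]
    refine c1.symm.trans (Eq.trans ?_ c2)
    refine intervalIntegral.integral_congr fun t ht => ?_
    rw [uIcc_of_le hsI.1.le] at ht
    exact (hE t ⟨ht.1, ht.2.trans hsI.2.le⟩ v).trans (real_inner_comm _ _)
  rw [intervalIntegral.integral_sub (hy.intervalIntegrable h0 hsI') iY, map_sub, map_sub,
    inner_sub_left, sub_apply, e1, intervalIntegral.integral_sub iF iw, hYw s hsI',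
    inner_sub_left, inner_add_left]
  have := hs v
  rw [inner_add_left] at this
  linarith

/-- The total error in `L²(I, H)`. -/
theorem normL2_dualInterp_sub_le (hι : ∀ v, ‖ι v‖ ≤ ‖v‖) {T : ℝ} (hT : 0 < T) (G : TimeGrid T)
    (hM : 2 ≤ G.M) {c₁ c₂ : ℝ} (hc₁ : 0 < c₁) (hc₁₂ : c₁ ≤ c₂) (hG : G.IsQuasiUniform c₁ c₂)
    {F w x z' : ℝ → H} {Y : ℝ → V} (hx : MemL2 T x) (hz' : MemL2 T z')
    (hF : ContinuousOn F (Icc 0 T)) (hY : ContinuousOn Y (Icc 0 T))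
    (hw : ∀ t ∈ Icc 0 T, w t = w 0 + ∫ s in (0:ℝ)..t, x s)
    (hYw : ∀ t ∈ Icc 0 T, ι (Y t) = ι (Y 0) + ∫ s in (0:ℝ)..t, w s)
    (hE : ∀ t ∈ Icc 0 T, ∀ v, energy ι (Y t) v = ⟪F t - w t, ι v⟫_ℝ)
    (hZ : ∀ t ∈ Icc 0 T, F t - w t = F 0 - w 0 + ∫ s in (0:ℝ)..t, z' s) {yk : ℝ → V}
    (ha : ∀ p : ℕ → V, p G.M = 0 →
      ∑ m ∈ Finset.range G.M, (-⟪ι (p (m + 1) - p m), ι (yk (G.mid m))⟫_ℝ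
          + G.step m * energy ι (yk (G.mid m)) ((1 / 2 : ℝ) • (p m + p (m + 1))))
        = (∑ m ∈ Finset.range G.M, ∫ t in G.t m..G.t (m + 1),
            ⟪F t, ι (p m + ((t - G.t m) / (G.t (m + 1) - G.t m)) • (p (m + 1) - p m))⟫_ℝ)
          + ⟪ι (Y 0), ι (p 0)⟫_ℝ) :
    normL2 T (fun t => ι (G.dualInterp yk t) - ι (Y t))
      ≤ ENNReal.ofReal (√(3 * (2 + c₁⁻¹ + c₂) + 2400) * G.width ^ 2)
        * (normL2 T x + normL2 T z') := by
  have hwc : ContinuousOn w (Icc 0 T) :=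
    (continuousOn_const.add (continuousOn_primitive hx)).congr hw
  have h1 := normL2_dualInterp_sub_sq_le (ι := ι) G hM hc₁ hG hx hY hw hYw yk
  have h2 := sum_error_mean_le hι G hF hwc hY hYw hE hz' hZ ha
  -- The factor 12 of the interpolation bound times the 1/4 of the mean-value error gives 3; 2400
  -- comes from the Taylor remainders.
  set K := 3 * (2 + c₁⁻¹ + c₂) + 2400 with hK
  have hc₂ : 0 < c₂ := hc₁.trans_le hc₁₂
  have hc₁' : 0 < c₁⁻¹ := inv_pos.mpr hc₁
  have hw0 : 0 ≤ G.width := (G.step_pos (m := 0) (by omega)).le.trans (G.step_le_width (by omega))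
  have hnorm : ∀ u : ℝ → H, MemL2 T u →
      ENNReal.ofReal (∫ s in (0:ℝ)..T, ‖u s‖ ^ 2) = normL2 T u ^ 2 := by
    intro u hu
    rw [normL2_sq_eq_lintegral, ← integral_Ioo_eq_intervalIntegral hT]
    exact ofReal_integral_eq_lintegral_ofReal (MemLp.integrable_norm_pow hu two_ne_zero)
      (Eventually.of_forall fun _ => sq_nonneg _)
  have hX0 : 0 ≤ ∫ s in (0:ℝ)..T, ‖x s‖ ^ 2 :=
    intervalIntegral.integral_nonneg hT.le fun _ _ => sq_nonneg _
  have hZ0 : 0 ≤ ∫ s in (0:ℝ)..T, ‖z' s‖ ^ 2 :=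
    intervalIntegral.integral_nonneg hT.le fun _ _ => sq_nonneg _
  have hW0 : 0 ≤ G.width ^ 4 := by positivity
  have h3 : 12 * (2 + c₁⁻¹ + c₂) * (∑ m ∈ Finset.range G.M,
          G.step m * ‖ι (yk (G.mid m) - mean G Y m)‖ ^ 2)
        + 2400 * G.width ^ 4 * ∫ s in (0:ℝ)..T, ‖x s‖ ^ 2
      ≤ (√K * G.width ^ 2) ^ 2
        * ((∫ s in (0:ℝ)..T, ‖x s‖ ^ 2) + ∫ s in (0:ℝ)..T, ‖z' s‖ ^ 2) := by
    rw [mul_pow, Real.sq_sqrt (by positivity)]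
    have m1 := mul_le_mul_of_nonneg_left h2 (by positivity : 0 ≤ 12 * (2 + c₁⁻¹ + c₂))
    have m2 : 0 ≤ 3 * (2 + c₁⁻¹ + c₂) * (G.width ^ 4 * ∫ s in (0:ℝ)..T, ‖x s‖ ^ 2) := by
      positivity
    have m3 : 0 ≤ 2400 * (G.width ^ 4 * ∫ s in (0:ℝ)..T, ‖z' s‖ ^ 2) := by positivity
    rw [hK]
    linarith
  have h4 := h1.trans (ENNReal.ofReal_le_ofReal h3)
  rw [ENNReal.ofReal_mul (sq_nonneg _), ENNReal.ofReal_add hX0 hZ0, hnorm x hx, hnorm z' hz',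
    ENNReal.ofReal_pow (by positivity)] at h4
  -- The estimate is compared in squared form, where the sum of two squares is at most the square of
  -- the sum.
  refine (ENNReal.pow_le_pow_left_iff two_ne_zero).mp (h4.trans ?_)
  rw [mul_pow]
  gcongr
  rw [add_sq]
  gcongr
  exact le_self_add

end Main

/-! ### Regularity and the error estimate for a weak solution -/

section Regularity

open scoped InnerProductSpace

/-- Regularity of the solution of the time-integrated equation, and the error estimate for its
Petrov–Galerkin approximations. -/
theorem exists_derivatives_and_error_le {V H : Type*} [NormedAddCommGroup V]
    [InnerProductSpace ℝ V] [CompleteSpace V] [NormedAddCommGroup H] [InnerProductSpace ℝ H]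
    [CompleteSpace H] {ι : V →L[ℝ] H} {T : ℝ} (hT : 0 < T) (hι : ∀ v, ‖ι v‖ ≤ ‖v‖)
    {c₁ c₂ : ℝ} (hc₁ : 0 < c₁) (hc₁₂ : c₁ ≤ c₂) {f f' : ℝ → H} {f₀ κ κ' : V} {y : ℝ → V}
    (hf : HasWeakTimeDeriv T f f') (hf₀ : HasInitialValue T f (ι f₀))
    (hκ : ∀ v, energy ι κ v = -⟪ι κ', ι v⟫_ℝ) (hy : MemL2 T y)
    (h : ∀ᵐ s ∂(volume.restrict (Ioo 0 T)), ∀ v, ⟪ι (y s), ι v⟫_ℝ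
      + energy ι (∫ t in (0:ℝ)..s, y t) v = ⟪ι κ + ∫ t in (0:ℝ)..s, f t, ι v⟫_ℝ) :
    ∃ y₁ y₂ z z₁ : ℝ → H,
      HasWeakTimeDeriv T (fun t => ι (y t)) y₁ ∧ HasWeakTimeDeriv T y₁ y₂ ∧
      (∀ᵐ t ∂(volume.restrict (Ioo 0 T)), ∃ u, ι (y t) = ι u ∧
        ∀ v, energy ι u v = -⟪z t, ι v⟫_ℝ) ∧
      HasWeakTimeDeriv T z z₁ ∧
      ∀ G : TimeGrid T, 2 ≤ G.M → G.IsQuasiUniform c₁ c₂ → ∀ yk : ℝ → V,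
        (∀ p : ℕ → V, p G.M = 0 →
          ∑ m ∈ Finset.range G.M, (-⟪ι (p (m + 1) - p m), ι (yk (G.mid m))⟫_ℝ
              + G.step m * energy ι (yk (G.mid m)) ((1 / 2 : ℝ) • (p m + p (m + 1))))
            = (∑ m ∈ Finset.range G.M, ∫ t in G.t m..G.t (m + 1),
                ⟪f t, ι (p m + ((t - G.t m) / (G.t (m + 1) - G.t m)) • (p (m + 1) - p m))⟫_ℝ)
              + ⟪ι κ, ι (p 0)⟫_ℝ) →
        normL2 T (fun t => ι (G.dualInterp yk t) - ι (y t))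
          ≤ ENNReal.ofReal (√(3 * (2 + c₁⁻¹ + c₂) + 2400) * G.width ^ 2)
            * (normL2 T y₂ + normL2 T z₁) := by
  have h0 : (0 : ℝ) ∈ Icc 0 T := left_mem_Icc.mpr hT.le
  have hf' := hf.memL2_deriv
  have hfF := hf.ae_eq_primitive hT hf₀
  obtain ⟨x, Y, hx, hYc, hYw, hE⟩ := exists_regular_solution hT hι hf' f₀ κ κ' hκ
  set F : ℝ → H := fun t => ι f₀ + ∫ s in (0:ℝ)..t, f' s with hF
  set w : ℝ → H := fun t => ι (f₀ + κ') + ∫ s in (0:ℝ)..t, x s with hw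
  have hFc : ContinuousOn F (Icc 0 T) := continuousOn_const.add (continuousOn_primitive hf')
  have hwc : ContinuousOn w (Icc 0 T) := continuousOn_const.add (continuousOn_primitive hx)
  have hF0 : F 0 = ι f₀ := by simp [hF]
  have hw0 : w 0 = ι (f₀ + κ') := by simp [hw]
  have hyY : ∀ᵐ t ∂(volume.restrict (Ioo 0 T)), ι (y t) = ι (Y t) := by
    refine ae_eq_of_integrated_equation hT hι hFc hwc hYc hYw hE hy ?_
    filter_upwards [h, self_mem_ae_restrict measurableSet_Ioo] with s hs hsI v
    rw [hs v, intervalIntegral_congr_Ioo (Ioo_subset_Icc_self hsI) hfF]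
  have hz' : MemL2 T (fun t => f' t - x t) := hf'.sub hx
  -- The Laplacian is read off from the equation as ∂_t y - f, so its time derivative needs only x
  -- and f'.
  refine ⟨w, x, fun t => w t - f t, fun t => x t - f' t,
    hasWeakTimeDeriv_of_primitive hT (ι κ) (memL2_of_continuousOn hwc) ?_,
    hasWeakTimeDeriv_of_primitive hT (ι (f₀ + κ')) hx (Eventually.of_forall fun _ => rfl), ?_,
    hasWeakTimeDeriv_of_primitive hT (ι (f₀ + κ') - ι f₀) (hx.sub hf') ?_,
    fun G hM hG yk ha => ?_⟩
  · filter_upwards [hyY, self_mem_ae_restrict measurableSet_Ioo] with t ht htI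
    rw [ht, hYw t (Ioo_subset_Icc_self htI)]
  · filter_upwards [hyY, hfF, self_mem_ae_restrict measurableSet_Ioo] with t ht hft htI
    refine ⟨Y t, ht, fun v => ?_⟩
    rw [hE t (Ioo_subset_Icc_self htI) v, hft, ← inner_neg_left, neg_sub]
  · filter_upwards [hfF, self_mem_ae_restrict measurableSet_Ioo] with t ht htI
    have htI' := Ioo_subset_Icc_self htI
    rw [ht, intervalIntegral.integral_sub (hx.intervalIntegrable h0 htI')
      (hf'.intervalIntegrable h0 htI'), add_sub_add_comm]
  · have hY0 : ι (Y 0) = ι κ := by simpa using hYw 0 h0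
    have key := normL2_dualInterp_sub_le hι hT G hM hc₁ hc₁₂ hG (F := F) (w := w) (x := x)
      (z' := fun t => f' t - x t) (Y := Y) (yk := yk) hx hz' hFc hYc
      (fun t _ => by rw [hw0]) (by rwa [hY0]) hE (fun t ht => ?_) (fun p hp => ?_)
    · have e1 : normL2 T (fun t => ι (G.dualInterp yk t) - ι (y t))
          = normL2 T (fun t => ι (G.dualInterp yk t) - ι (Y t)) := by
        refine eLpNorm_congr_ae ?_
        filter_upwards [hyY] with t ht
        rw [ht]
      have e2 : normL2 T (fun t => x t - f' t) = normL2 T (fun t => f' t - x t) :=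
        eLpNorm_sub_comm _ _ _ _
      rwa [e1, e2]
    · rw [hF0, hw0, intervalIntegral.integral_sub (hf'.intervalIntegrable h0 ht)
        (hx.intervalIntegrable h0 ht), ← add_sub_add_comm]
    · rw [ha p hp, hY0]
      congr 1
      refine Finset.sum_congr rfl fun m hm => ?_
      have hm' := Finset.mem_range.mp hm
      have hsub : Ioo (G.t m) (G.t (m + 1)) ⊆ Ioo 0 T :=
        Ioo_subset_Ioo (G.t_nonneg hm'.le) (G.t_le (Nat.succ_le_of_lt hm'))
      rw [intervalIntegral.integral_of_le (G.lt m hm').le,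
        intervalIntegral.integral_of_le (G.lt m hm').le, integral_Ioc_eq_integral_Ioo,
        integral_Ioc_eq_integral_Ioo]
      refine integral_congr_ae ?_
      -- The discrete equation sees f only under integrals, so f may be replaced by its continuous
      -- representative F.
      filter_upwards [ae_restrict_of_ae_restrict_of_subset hsub hfF] with t ht
      rw [ht]

end Regularity

end

end PetrovGalerkin

theorem lemmaL {n : ℕ} (hn : n = 2 ∨ n = 3) {Ω : Set (Space n)}
    (hΩ : IsConvexPolygonalDomain Ω) {T : ℝ} (hT : 0 < T)
    {c₁ c₂ : ℝ} (hc₁ : 0 < c₁) (hc₁₂ : c₁ ≤ c₂) :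
    ∃ C : ℝ, 0 < C ∧
      ∀ (f f' : ℝ → L2 Ω) (f₀ κ κ' : H10 Ω) (y : ℝ → H10 Ω),
        HasWeakTimeDeriv T f f' →
        HasInitialValue T f (val f₀) →
        HasLaplacian (val κ) (val κ') →
        IsWeakSolution T (fun t => toHm1 (f t)) (val κ) y →
        ∃ y₁ y₂ z z₁ : ℝ → L2 Ω,
          HasWeakTimeDeriv T (fun t => val (y t)) y₁ ∧
          HasWeakTimeDeriv T y₁ y₂ ∧
          (∀ᵐ t ∂(volume.restrict (Ioo 0 T)), HasLaplacian (val (y t)) (z t)) ∧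
          HasWeakTimeDeriv T z z₁ ∧
          ∀ G : TimeGrid T, 2 ≤ G.M → G.IsQuasiUniform c₁ c₂ →
            ∀ (yk : ℝ → H10 Ω) (ykT : L2 Ω),
              IsDiscreteSolution G (fun t => toHm1 (f t)) (val κ) yk ykT →
              normL2 T (fun t => val (G.dualInterp yk t) - val (y t)) ≤
                ENNReal.ofReal (C * G.width ^ 2) * (normL2 T y₂ + normL2 T z₁) := by
  have hc₂ : 0 < c₂ := hc₁.trans_le hc₁₂
  refine ⟨√(3 * (2 + c₁⁻¹ + c₂) + 2400), by positivity, fun f f' f₀ κ κ' y hf hf₀ hκ hy => ?_⟩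
  obtain ⟨y₁, y₂, z, z₁, h1, h2, h3, h4, h5⟩ := exists_derivatives_and_error_le hT norm_val_le
    hc₁ hc₁₂ hf hf₀ (fun v => (energy_val κ v).trans ((hasLaplacian_val_iff κ _).mp hκ v)) hy.memL2
    (hy.integrated_equation hT hf.memL2)
  refine ⟨y₁, y₂, z, z₁, h1, h2, ?_, h4, fun G hM hG yk ykT hyk =>
    h5 G hM hG yk fun p hp => hyk.sum_eq hT hf.memL2 hp⟩
  filter_upwards [h3] with t ⟨u, hu, huz⟩
  -- The variational equation is known for a u with the same image in L²(Ω) as y(t), and the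
  -- distributional Laplacian depends only on that image.
  rw [hu, hasLaplacian_val_iff]
  exact fun v => (energy_val u v).symm.trans (huz v)
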